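/- Let $\rho=\rho^{ABC}$ be an arbitrary (mixed) state of three finite-dimensional quantum systems held by Alice, Bob and Charlie. For a state $\sigma^{XY}$ let $I^{X:Y}(\sigma)=S(\sigma^X)+S(\sigma^Y)-S(\sigma^{XY})$ be the quantum mutual information, where $S(\sigma)=-\mathrm{Tr}(\sigma\log_2\sigma)$, and let $F(\sigma,\tau)=\mathrm{Tr}\sqrt{\sqrt{\sigma}\,\tau\sqrt{\sigma}}$ be the Uhlmann fidelity. If Charlie also holds a finite-dimensional register $R$ in a state $\rho^R$, and $\Lambda$ is an LOCC protocol (finitely many rounds of local quantum instruments with two-way classical communication of the outcomes; Alice's system is not acted on) between Bob, holding $B$, and Charlie, holding $CR$, put $\sigma_f=\mathrm{Tr}_B\,\Lambda[\rho^{ABC}\otimes\rho^R]$, a state of $ACR$. Define the concentrated information and the fidelity of LOCC quantum state merging (LQSM) by $$\mathcal I(\rho)=\sup_{R,\rho^R,\Lambda} I^{A:CR}(\sigma_f),\qquad \mathcal F(\rho)=\sup_{\rho^R,\Lambda}F(\sigma_f,\sigma_t),$$ where in the definition of $\mathcal F$ the register $R$ is a copy of $B$ and $\sigma_t=\sigma_t^{ACR}$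 is the state $\rho^{ABC}$ with the systems $B$ and $R$ relabelled. For $n$ copies, $\rho^{\otimes n}$ is regarded as a tripartite state on $A^n$, $B^n$, $C^n$. Then perfect asymptotic LQSM implies perfect asymptotic information concentration: if $$\mathcal F^\infty(\rho):=\lim_{n\to\infty}\mathcal F(\rho^{\otimes n})=1,$$ then the limit $\mathcal I^\infty(\rho):=\lim_{n\to\infty}\frac1n\,\mathcal I(\rho^{\otimes n})$ exists and $$\mathcal I^\infty(\rho)=I^{A:BC}(\rho).$$ -/

import Mathlib

open Filter Topology
open scoped Kronecker Matrix ComplexOrder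

universe u v w

namespace QInfo

noncomputable section

/-- Quantum states of the system with orthonormal basis labelled by the finite set `X`. -/
def IsState {X : Type u} [Fintype X] (ρ : Matrix X X ℂ) : Prop :=
  ρ.PosSemidef ∧ ρ.trace = 1

/-- Partial trace over the first factor. -/
def traceFst {X : Type u} {Y : Type v} [Fintype X] (ρ : Matrix (X × Y) (X × Y) ℂ) :
    Matrix Y Y ℂ :=
  fun y y' => ∑ x, ρ (x, y) (x, y')

/-- Partial trace over the second factor. -/
def traceSnd {X : Type u} {Y : Type v} [Fintype Y] (ρ : Matrix (X × Y) (X × Y) ℂ) :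
    Matrix X X ℂ :=
  fun x x' => ∑ y, ρ (x, y) (x', y)

/-- Partial trace over Bob's (the middle) system. -/
def traceBob {A : Type u} {B : Type v} {C : Type w} [Fintype B]
    (ρ : Matrix (A × B × C) (A × B × C) ℂ) : Matrix (A × C) (A × C) ℂ :=
  fun x x' => ∑ b, ρ (x.1, b, x.2) (x'.1, b, x'.2)

/-- Von Neumann entropy `S(ρ) = - Tr (ρ log₂ ρ)`, through the continuous functional calculus
(with `0 log 0 = 0`). -/
def entropy {X : Type u} [Fintype X] [DecidableEq X] (ρ : Matrix X X ℂ) : ℝ :=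
  (cfc (fun x : ℝ => -(x * Real.logb 2 x)) ρ).trace.re

/-- Quantum mutual information `I^{X:Y}(ρ) = S(ρ^X) + S(ρ^Y) - S(ρ^{XY})`. -/
def mutualInfo {X : Type u} {Y : Type v} [Fintype X] [DecidableEq X] [Fintype Y] [DecidableEq Y]
    (ρ : Matrix (X × Y) (X × Y) ℂ) : ℝ :=
  entropy (traceSnd ρ) + entropy (traceFst ρ) - entropy ρ

/-- Uhlmann fidelity `F(ρ, σ) = Tr √(√ρ σ √ρ)`. -/
def fidelity {X : Type u} [Fintype X] [DecidableEq X] (ρ σ : Matrix X X ℂ) : ℝ :=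
  (cfc Real.sqrt (cfc Real.sqrt ρ * σ * cfc Real.sqrt ρ)).trace.re

open Classical in
/-- The operators `K i j` from `X` to `Y` are the Kraus operators of a quantum instrument: outcome
`i` is associated with the completely positive map `σ ↦ ∑ j, K i j σ (K i j)ᴴ`, and the sum of these
maps over all outcomes is trace preserving. -/
def IsInstrument {X : Type u} {Y : Type v} [Fintype Y] {k m : ℕ}
    (K : Fin k → Fin m → Matrix Y X ℂ) : Prop :=
  ∑ i, ∑ j, (K i j)ᴴ * K i j = 1

/-- `LOCC B' C' B C` is the type of LOCC protocols, with finitely many rounds, which start with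
Bob and Charlie holding systems `B` and `C` and end with them holding `B'` and `C'`.
In each round one of the two parties applies a local quantum instrument and tells the outcome `i`
to the other one; the rest of the protocol may depend on `i`. The local systems
may change from round to round, so that local ancillas can be added and discarded. -/
inductive LOCC (B' : Type u) (C' : Type v) : Type u → Type v → Type (max u v + 1)
  | done : LOCC B' C' B' C'
  | bob {B : Type u} {C : Type v} {X : Type u} [Fintype X] [DecidableEq X] {k m : ℕ}
      (K : Fin k → Fin m → Matrix X B ℂ) (hK : IsInstrument K)
      (next : Fin k → LOCC B' C' X C) : LOCC B' C' B C
  | charlie {B : Type u} {C : Type v} {X : Type v} [Fintype X] [DecidableEq X] {k m : ℕ}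
      (K : Fin k → Fin m → Matrix X C ℂ) (hK : IsInstrument K)
      (next : Fin k → LOCC B' C' B X) : LOCC B' C' B C

/-- The channel `Λ` on the operators of Alice, Bob and Charlie that is implemented by an LOCC
protocol of Bob and Charlie; Alice's system is left alone. -/
def LOCC.apply {A : Type w} [Fintype A] [DecidableEq A] {B' : Type u} {C' : Type v} :
    {B : Type u} → {C : Type v} → [Fintype B] → [DecidableEq B] → [Fintype C] → [DecidableEq C] →
      LOCC B' C' B C → Matrix (A × B × C) (A × B × C) ℂ → Matrix (A × B' × C') (A × B' × C') ℂ
  | _, _, _, _, _, _, .done, σ => σ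
  | _, C, _, _, _, _, @LOCC.bob _ _ _ _ X _instX _decX _ _ K _ next, σ =>
      ∑ i, LOCC.apply (B := X) (C := C) (next i) (∑ j,
        ((1 : Matrix A A ℂ) ⊗ₖ (K i j ⊗ₖ (1 : Matrix C C ℂ))) * σ *
          ((1 : Matrix A A ℂ) ⊗ₖ (K i j ⊗ₖ (1 : Matrix C C ℂ)))ᴴ)
  | B, _, _, _, _, _, @LOCC.charlie _ _ _ _ X _instX _decX _ _ K _ next, σ =>
      ∑ i, LOCC.apply (B := B) (C := X) (next i) (∑ j,
        ((1 : Matrix A A ℂ) ⊗ₖ ((1 : Matrix B B ℂ) ⊗ₖ K i j)) * σ *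
          ((1 : Matrix A A ℂ) ⊗ₖ ((1 : Matrix B B ℂ) ⊗ₖ K i j))ᴴ)

section Tripartite

variable {A : Type u} {B : Type v} {C : Type w}

/-- The initial state `ρ^{ABC} ⊗ τ^R`, where the register `R` belongs to Charlie. -/
def withRegister {R : Type*} (ρ : Matrix (A × B × C) (A × B × C) ℂ) (τ : Matrix R R ℂ) :
    Matrix (A × B × C × R) (A × B × C × R) ℂ :=
  fun x y => ρ (x.1, x.2.1, x.2.2.1) (y.1, y.2.1, y.2.2.1) * τ x.2.2.2 y.2.2.2

/-- The target state on `A(CR)`, `R` being a copy of `B`: the state `ρ^{ABC}` with the systems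
`B` and `R` relabelled. -/
def target (ρ : Matrix (A × B × C) (A × B × C) ℂ) : Matrix (A × C × B) (A × C × B) ℂ :=
  fun x y => ρ (x.1, x.2.2, x.2.1) (y.1, y.2.2, y.2.1)

/-- The state `ρ^{⊗ n}`, as a tripartite state on `A^n`, `B^n`, `C^n`. -/
def copies (ρ : Matrix (A × B × C) (A × B × C) ℂ) (n : ℕ) :
    Matrix ((Fin n → A) × (Fin n → B) × (Fin n → C)) ((Fin n → A) × (Fin n → B) × (Fin n → C)) ℂ :=
  fun x y => ∏ i, ρ (x.1 i, x.2.1 i, x.2.2 i) (y.1 i, y.2.1 i, y.2.2 i)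

variable [Fintype A] [DecidableEq A] [Fintype B] [DecidableEq B] [Fintype C] [DecidableEq C]

/-- Concentrated information `𝓘(ρ)`: the supremum of `I^{A:CR}(Tr_B Λ[ρ ⊗ τ^R])` over all
finite-dimensional registers `R` in a state `τ` and all LOCC protocols `Λ` of Bob and Charlie. -/
def concentratedInfo (ρ : Matrix (A × B × C) (A × B × C) ℂ) : ℝ :=
  sSup {x : ℝ | ∃ (r : ℕ) (τ : Matrix (Fin r) (Fin r) ℂ)
    (P : LOCC B (C × Fin r) B (C × Fin r)),
      IsState τ ∧ x = mutualInfo (traceBob (P.apply (withRegister ρ τ)))}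

/-- Fidelity of LOCC quantum state merging `𝓕(ρ)`: the supremum of `F(Tr_B Λ[ρ ⊗ τ^R], σ_t)` over
the states `τ` of the register `R` (a copy of `B`) and all LOCC protocols `Λ` of Bob and Charlie,
where `σ_t` is the target state. -/
def mergingFidelity (ρ : Matrix (A × B × C) (A × B × C) ℂ) : ℝ :=
  sSup {x : ℝ | ∃ (τ : Matrix B B ℂ) (P : LOCC B (C × B) B (C × B)),
      IsState τ ∧ x = fidelity (traceBob (P.apply (withRegister ρ τ))) (target ρ)}

end Tripartite

end

end QInfo

/-!
Perfect merging concentrates all of `I^{A:BC}(ρ)` at Charlie, because two bounds meet.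

*Upper bound.* Adding the register, an LOCC protocol of Bob and Charlie, and tracing out Bob are
all channels on the system held jointly by Bob and Charlie (`LOCC.exists_localMap`,
`exists_withRegister_eq_localMap`, `exists_traceBob_eq_localMap`). Such channels do not increase the
mutual information with Alice (`mutualInfo_localMap_le`), so that `𝓘(ρ^{⊗ n}) ≤ I(ρ^{⊗ n})`, which
is `n I(ρ)` by `mutualInfo_copies`. The mutual information is the relative entropy of `ρ` to the
product of its marginals, and monotonicity is the data-processing inequality
`relEntropy_krausMap_le`. For the latter, the relative entropy is a mixture over `t > 0`
of the resolvent quantities `⟨ρ, (L_σ + t R_ρ)⁻¹ ρ⟩`, where `L_σ` and `R_ρ` are the left and right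
multiplication by `σ` and `ρ`. Each of them is the maximum over `X` of
`2 Re Tr Xᴴρ - Tr XᴴσX - t Tr XρXᴴ` (`resolventForm`), and the Kadison–Schwarz inequality for the
adjoint channel compares these maxima. The mixture is not written as an integral: the derivative
in `t` of the mean value of `log (r + t)` is a resolvent, and `sum_log_le_of_resolvent_le` concludes
by monotonicity.

*Lower bound.* If the merging fidelity is close to `1`, then some protocol produces a
state `σ_f` that differs from the target by little, in the sense that `σ_f + B = σ_t + C` with
`B, C ≥ 0` of small trace (`exists_add_eq_add_of_fidelity`). The entropies of the two states and
of their marginals then differ by at most the trace of `C` times the logarithm of the dimension, up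
to a constant (`entropy_mul_log_two_le_add`). The bounds on the entropy of `σ_f + B` that this
requires are again comparisons of resolvent forms: Klein's inequality `le_relEntropy`, and
`relEntropy_add_right_le`, which plays the part of the operator monotonicity of the logarithm. For
`n` copies the logarithm of the dimension grows linearly in `n`, hence `𝓘(ρ^{⊗ n}) ≥ n I(ρ) - o(n)`.
The register of the merging protocol is a copy of `B^n`, whereas the concentrated information is
defined with registers `Fin r`; `LOCC.exists_relabel` carries the protocol over.
-/

universe x

set_option linter.unusedSectionVars false

namespace QInfo

open Matrix

/-! ### Eigendecompositions and the functional calculus -/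

/-- `ρ = U diag(a) Uᴴ` with `U` unitary and `a` real: the columns of `U` form an orthonormal
eigenbasis of `ρ`, with eigenvalues `a`. The basis is arbitrary, so that product bases
can be used for product operators. -/
structure IsEigendecomposition {n : Type*} [Fintype n] [DecidableEq n] (ρ U : Matrix n n ℂ)
    (a : n → ℝ) : Prop where
  conjTranspose_mul : Uᴴ * U = 1
  mul_conjTranspose : U * Uᴴ = 1
  eq_conj : ρ = U * diagonal (fun i => (a i : ℂ)) * Uᴴ

namespace IsEigendecomposition

section

variable {n m : Type*} [Fintype n] [DecidableEq n] [Fintype m] [DecidableEq m]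
  {ρ U : Matrix n n ℂ} {a : n → ℝ} {σ V : Matrix m m ℂ} {b : m → ℝ}

theorem of_isHermitian (h : ρ.IsHermitian) :
    IsEigendecomposition ρ h.eigenvectorUnitary h.eigenvalues where
  conjTranspose_mul := Unitary.coe_star_mul_self h.eigenvectorUnitary
  mul_conjTranspose := Unitary.coe_mul_star_self h.eigenvectorUnitary
  eq_conj := by
    conv_lhs => rw [h.spectral_theorem]
    rfl

theorem isHermitian (h : IsEigendecomposition ρ U a) : ρ.IsHermitian := by
  rw [h.eq_conj]
  refine isHermitian_mul_mul_conjTranspose U ?_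
  rw [IsHermitian, diagonal_conjTranspose]
  congr 1
  ext i
  simp

theorem mul_eq (h : IsEigendecomposition ρ U a) :
    ρ * U = U * diagonal (fun i => (a i : ℂ)) := by
  rw [h.eq_conj, Matrix.mul_assoc, h.conjTranspose_mul, Matrix.mul_one]

theorem conjTranspose_mul_eq (h : IsEigendecomposition ρ U a) :
    Uᴴ * ρ = diagonal (fun i => (a i : ℂ)) * Uᴴ := by
  rw [h.eq_conj, ← Matrix.mul_assoc, ← Matrix.mul_assoc, h.conjTranspose_mul, Matrix.one_mul]

theorem nonneg (h : IsEigendecomposition ρ U a) (hρ : ρ.PosSemidef) (i : n) : 0 ≤ a i := by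
  have h1 := (hρ.conjTranspose_mul_mul_same U).diag_nonneg (i := i)
  rw [Matrix.mul_assoc, h.mul_eq, ← Matrix.mul_assoc, h.conjTranspose_mul, Matrix.one_mul,
    diagonal_apply_eq] at h1
  exact_mod_cast h1

/-- The functional calculus may be computed in any eigenbasis: the change of basis between two
eigenbases only connects equal eigenvalues. -/
theorem cfc_eq (h : IsEigendecomposition ρ U a) (f : ℝ → ℝ) :
    cfc f ρ = U * diagonal (fun i => (f (a i) : ℂ)) * Uᴴ := by
  have h' := of_isHermitian h.isHermitian
  rw [h.isHermitian.cfc_eq, IsHermitian.cfc, Unitary.conjStarAlgAut_apply]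
  set W : Matrix n n ℂ := (h.isHermitian.eigenvectorUnitary).1
  set c := h.isHermitian.eigenvalues
  have key : diagonal (fun i => (f (a i) : ℂ)) * (Uᴴ * W)
      = (Uᴴ * W) * diagonal (fun i => (f (c i) : ℂ)) := by
    have h1 : diagonal (fun i => (a i : ℂ)) * (Uᴴ * W)
        = (Uᴴ * W) * diagonal (fun i => (c i : ℂ)) := by
      rw [← Matrix.mul_assoc, ← h.conjTranspose_mul_eq, Matrix.mul_assoc, h'.mul_eq,
        Matrix.mul_assoc]
    ext i j
    have h2 := congrFun (congrFun h1 i) j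
    rw [diagonal_mul, mul_diagonal] at h2 ⊢
    by_cases h0 : (Uᴴ * W) i j = 0
    · simp [h0]
    · rw [mul_comm] at h2
      have h3 : a i = c j := by exact_mod_cast mul_left_cancel₀ h0 h2
      rw [h3, mul_comm]
  have hW : W * Wᴴ = 1 := h'.mul_conjTranspose
  calc W * diagonal (fun i => (f (c i) : ℂ)) * Wᴴ
      = U * ((Uᴴ * W) * diagonal (fun i => (f (c i) : ℂ))) * Wᴴ := by
        rw [← Matrix.mul_assoc U, ← Matrix.mul_assoc U, h.mul_conjTranspose, Matrix.one_mul]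
    _ = U * diagonal (fun i => (f (a i) : ℂ)) * Uᴴ * (W * Wᴴ) := by
        rw [← key]; simp only [Matrix.mul_assoc]
    _ = _ := by rw [hW, Matrix.mul_one]

theorem conj_mul_conj (h : IsEigendecomposition ρ U a) (d e : n → ℂ) :
    (U * diagonal d * Uᴴ) * (U * diagonal e * Uᴴ) = U * diagonal (fun i => d i * e i) * Uᴴ := by
  have : (U * diagonal d * Uᴴ) * (U * diagonal e * Uᴴ)
      = U * (diagonal d * (Uᴴ * U) * diagonal e) * Uᴴ := by simp only [Matrix.mul_assoc]
  rw [this, h.conjTranspose_mul, Matrix.mul_one, diagonal_mul_diagonal]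

protected theorem cfc (h : IsEigendecomposition ρ U a) (f : ℝ → ℝ) :
    IsEigendecomposition (cfc f ρ) U (f ∘ a) :=
  ⟨h.conjTranspose_mul, h.mul_conjTranspose, h.cfc_eq f⟩

theorem posSemidef (h : IsEigendecomposition ρ U a) (ha : ∀ i, 0 ≤ a i) : ρ.PosSemidef := by
  rw [h.eq_conj]
  refine PosSemidef.mul_mul_conjTranspose_same (posSemidef_diagonal_iff.2 fun i => ?_) U
  exact_mod_cast ha i

theorem trace_conj (h : IsEigendecomposition ρ U a) (d : n → ℂ) :
    (U * diagonal d * Uᴴ).trace = ∑ i, d i := by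
  rw [trace_mul_comm, ← Matrix.mul_assoc, h.conjTranspose_mul, Matrix.one_mul, trace_diagonal]

theorem trace_eq (h : IsEigendecomposition ρ U a) : ρ.trace = ((∑ i, a i : ℝ) : ℂ) := by
  conv_lhs => rw [h.eq_conj]
  rw [h.trace_conj]
  push_cast
  rfl

theorem entropy_eq (h : IsEigendecomposition ρ U a) :
    entropy ρ = (∑ i, Real.negMulLog (a i)) / Real.log 2 := by
  rw [entropy, h.cfc_eq, h.trace_conj, Complex.re_sum, Finset.sum_div]
  refine Finset.sum_congr rfl fun i _ => ?_
  rw [Complex.ofReal_re, Real.negMulLog, Real.logb]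
  ring

theorem kronecker (h : IsEigendecomposition ρ U a) (h' : IsEigendecomposition σ V b) :
    IsEigendecomposition (ρ ⊗ₖ σ) (U ⊗ₖ V) (fun p => a p.1 * b p.2) where
  conjTranspose_mul := by
    rw [conjTranspose_kronecker, ← mul_kronecker_mul, h.conjTranspose_mul, h'.conjTranspose_mul,
      one_kronecker_one]
  mul_conjTranspose := by
    rw [conjTranspose_kronecker, ← mul_kronecker_mul, h.mul_conjTranspose, h'.mul_conjTranspose,
      one_kronecker_one]
  eq_conj := by
    conv_lhs => rw [h.eq_conj, h'.eq_conj]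
    rw [mul_kronecker_mul, mul_kronecker_mul, diagonal_kronecker_diagonal,
      conjTranspose_kronecker]
    push_cast
    rfl

theorem submatrix (h : IsEigendecomposition ρ U a) (e : m ≃ n) :
    IsEigendecomposition (ρ.submatrix e e) (U.submatrix e e) (a ∘ e) where
  conjTranspose_mul := by
    rw [conjTranspose_submatrix, submatrix_mul_equiv, h.conjTranspose_mul, submatrix_one_equiv]
  mul_conjTranspose := by
    rw [conjTranspose_submatrix, submatrix_mul_equiv, h.mul_conjTranspose, submatrix_one_equiv]
  eq_conj := by
    conv_lhs => rw [h.eq_conj]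
    rw [conjTranspose_submatrix, ← submatrix_mul_equiv _ _ e e e, ← submatrix_mul_equiv _ _ e e e,
      submatrix_diagonal_equiv]
    rfl

end

end IsEigendecomposition

theorem posSemidef_cfc {n : Type*} [Fintype n] [DecidableEq n] {ρ : Matrix n n ℂ}
    (hρ : ρ.IsHermitian) {f : ℝ → ℝ} (hf : ∀ x, 0 ≤ f x) : (cfc f ρ).PosSemidef :=
  ((IsEigendecomposition.of_isHermitian hρ).cfc f).posSemidef fun _ => hf _

theorem cfc_sqrt_mul_self {n : Type*} [Fintype n] [DecidableEq n] {ρ : Matrix n n ℂ}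
    (hρ : ρ.PosSemidef) : cfc Real.sqrt ρ * cfc Real.sqrt ρ = ρ := by
  have h := IsEigendecomposition.of_isHermitian hρ.1
  have ha := h.nonneg hρ
  rw [h.cfc_eq, h.conj_mul_conj]
  conv_rhs => rw [h.eq_conj]
  congr 3
  ext i
  rw [← Complex.ofReal_mul, Real.mul_self_sqrt (ha _)]

theorem entropy_submatrix_equiv {n m : Type*} [Fintype n] [DecidableEq n] [Fintype m]
    [DecidableEq m] {ρ : Matrix n n ℂ} (hρ : ρ.IsHermitian) (e : m ≃ n) :
    entropy (ρ.submatrix e e) = entropy ρ := by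
  have h := IsEigendecomposition.of_isHermitian hρ
  rw [(h.submatrix e).entropy_eq, h.entropy_eq]
  congr 1
  exact Equiv.sum_comp e (fun i => Real.negMulLog (hρ.eigenvalues i))

/-! ### Relative entropy and the resolvent form -/

/-- Mean logarithms are compared by comparing mean resolvents. This is the representation
`log r = ∫₀^∞ (1 / (1 + t) - 1 / (r + t)) dt` without the integral; equal total weights
dispose of the first summand. -/
theorem sum_log_le_of_resolvent_le {ι κ : Type*} [Fintype ι] [Fintype κ] {w r : ι → ℝ}
    {w' r' : κ → ℝ} (hr : ∀ i, 0 < r i) (hr' : ∀ k, 0 < r' k)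
    (hsum : ∑ i, w i = ∑ k, w' k)
    (hres : ∀ t : ℝ, 0 < t → ∑ k, w' k / (r' k + t) ≤ ∑ i, w i / (r i + t)) :
    ∑ i, w i * Real.log (r i) ≤ ∑ k, w' k * Real.log (r' k) := by
  -- `h` is antitone on `[0, ∞)` and tends to `0`, because the total weights agree.
  set h : ℝ → ℝ := fun t =>
    ∑ k, w' k * Real.log (r' k + t) - ∑ i, w i * Real.log (r i + t) with hh
  have hder : ∀ t : ℝ, 0 ≤ t →
      HasDerivAt h (∑ k, w' k / (r' k + t) - ∑ i, w i / (r i + t)) t := by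
    intro t ht
    refine HasDerivAt.sub (HasDerivAt.fun_sum fun k _ => ?_) (HasDerivAt.fun_sum fun i _ => ?_)
    · have := (((hasDerivAt_id t).const_add (r' k)).log
        (by have := hr' k; simp only [id]; positivity)).const_mul (w' k)
      simpa [div_eq_mul_inv] using this
    · have := (((hasDerivAt_id t).const_add (r i)).log
        (by have := hr i; simp only [id]; positivity)).const_mul (w i)
      simpa [div_eq_mul_inv] using this
  have hanti : AntitoneOn h (Set.Ici 0) := by
    refine antitoneOn_of_deriv_nonpos (convex_Ici 0)
      (fun t ht => (hder t ht).continuousAt.continuousWithinAt) ?_ ?_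
    · intro t ht
      rw [interior_Ici] at ht
      exact (hder t (le_of_lt ht)).differentiableAt.differentiableWithinAt
    · intro t ht
      rw [interior_Ici] at ht
      rw [(hder t (le_of_lt ht)).deriv]
      exact sub_nonpos.2 (hres t ht)
  have hterm : ∀ x : ℝ, 0 < x → Tendsto (fun t : ℝ => Real.log (x + t) - Real.log t) atTop (𝓝 0) := by
    intro x hx
    have h1 : Tendsto (fun t : ℝ => x / t + 1) atTop (𝓝 1) := by
      simpa using (tendsto_const_nhds (x := x)).div_atTop tendsto_id |>.add_const 1
    have h2 := h1.log one_ne_zero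
    rw [Real.log_one] at h2
    refine h2.congr' ?_
    filter_upwards [eventually_gt_atTop 0] with t ht
    rw [← Real.log_div (by positivity) ht.ne']
    congr 1
    field_simp
  have hlim : Tendsto h atTop (𝓝 0) := by
    have h1 : Tendsto (fun t : ℝ => ∑ k, w' k * (Real.log (r' k + t) - Real.log t)
        - ∑ i, w i * (Real.log (r i + t) - Real.log t)) atTop (𝓝 0) := by
      have a1 : Tendsto (fun t : ℝ => ∑ k, w' k * (Real.log (r' k + t) - Real.log t)) atTop
          (𝓝 (∑ k, w' k * 0)) :=
        tendsto_finsetSum _ fun k _ => (hterm _ (hr' k)).const_mul _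
      have a2 : Tendsto (fun t : ℝ => ∑ i, w i * (Real.log (r i + t) - Real.log t)) atTop
          (𝓝 (∑ i, w i * 0)) :=
        tendsto_finsetSum _ fun i _ => (hterm _ (hr i)).const_mul _
      simpa using a1.sub a2
    refine h1.congr fun t => ?_
    simp only [hh, mul_sub, Finset.sum_sub_distrib, ← Finset.sum_mul, hsum]
    ring
  have h0 : 0 ≤ h 0 := by
    refine le_of_tendsto hlim ?_
    filter_upwards [eventually_ge_atTop 0] with t ht
    exact hanti Set.self_mem_Ici ht ht
  simpa [hh] using h0

section

variable {n m : Type*} [Fintype n] [DecidableEq n] [Fintype m] [DecidableEq m]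

/-- Umegaki's relative entropy `Tr ρ (log ρ - log σ)` with the natural logarithm, in which
`log 0` is read as `0`. It is the usual one when the kernel of `σ` is contained in that of `ρ`,
and is used only in this case. -/
noncomputable def relEntropy (ρ σ : Matrix n n ℂ) : ℝ :=
  (ρ * cfc Real.log ρ).trace.re - (ρ * cfc Real.log σ).trace.re

/-- The kernel of `σ` is contained in the kernel of `ρ`. -/
def KerLE (σ ρ : Matrix n n ℂ) : Prop :=
  ∀ v : n → ℂ, σ *ᵥ v = 0 → ρ *ᵥ v = 0

/-- The quadratic functional whose supremum over `X` is
`⟨ρ, (L_σ + t R_ρ)⁻¹ ρ⟩`, with `L_σ` and `R_ρ` the left and right multiplication by `σ` and `ρ`. -/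
noncomputable def resolventForm (t : ℝ) (ρ σ X : Matrix n n ℂ) : ℝ :=
  2 * (Xᴴ * ρ).trace.re - (Xᴴ * σ * X).trace.re - t * (X * ρ * Xᴴ).trace.re

theorem trace_conjTranspose_mul_diagonal_mul {k l : Type*} [Fintype k] [Fintype l] [DecidableEq k]
    (Y : Matrix k l ℂ) (b : k → ℝ) :
    (Yᴴ * diagonal (fun j => (b j : ℂ)) * Y).trace.re
      = ∑ i, ∑ j, b j * Complex.normSq (Y j i) := by
  simp only [trace, diag_apply]
  rw [Complex.re_sum]
  refine Finset.sum_congr rfl fun i _ => ?_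
  rw [Matrix.mul_apply, Complex.re_sum]
  refine Finset.sum_congr rfl fun j _ => ?_
  rw [mul_diagonal, conjTranspose_apply]
  simp only [Complex.normSq_apply, Complex.star_def, Complex.mul_re, Complex.mul_im,
    Complex.conj_re, Complex.conj_im, Complex.ofReal_re, Complex.ofReal_im]
  ring

variable {ρ σ U V : Matrix n n ℂ} {a b : n → ℝ}

theorem IsEigendecomposition.sum_overlap (h : IsEigendecomposition ρ U a)
    (h' : IsEigendecomposition σ V b) (i : n) : ∑ j, Complex.normSq ((Uᴴ * V) i j) = 1 := by
  have e3 : (Uᴴ * V) * (Uᴴ * V)ᴴ = 1 := by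
    rw [Matrix.conjTranspose_mul, conjTranspose_conjTranspose, Matrix.mul_assoc, ← Matrix.mul_assoc V,
      h'.mul_conjTranspose, Matrix.one_mul, h.conjTranspose_mul]
  have e4 := congrArg Complex.re (congrFun (congrFun e3 i) i)
  rw [mul_apply, Complex.re_sum, one_apply_eq, Complex.one_re] at e4
  rw [← e4]
  refine Finset.sum_congr rfl fun j _ => ?_
  rw [conjTranspose_apply, Complex.star_def, Complex.mul_conj, Complex.ofReal_re]

theorem relEntropy_eq_sum (h : IsEigendecomposition ρ U a) (h' : IsEigendecomposition σ V b) :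
    relEntropy ρ σ = ∑ i, ∑ j, a i * Complex.normSq ((Uᴴ * V) i j) *
      (Real.log (a i) - Real.log (b j)) := by
  have h1 : (ρ * cfc Real.log ρ).trace.re =
      ∑ i, ∑ j, a i * Complex.normSq ((Uᴴ * V) i j) * Real.log (a i) := by
    have e1 : ρ * cfc Real.log ρ
        = U * diagonal (fun i => ((a i * Real.log (a i) : ℝ) : ℂ)) * Uᴴ := by
      conv_lhs => rw [h.cfc_eq, ← Matrix.mul_assoc, ← Matrix.mul_assoc, h.mul_eq, Matrix.mul_assoc U,
        diagonal_mul_diagonal]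
      push_cast
      rfl
    rw [e1, h.trace_conj, Complex.re_sum]
    refine Finset.sum_congr rfl fun i _ => ?_
    rw [Complex.ofReal_re, ← Finset.sum_mul, ← Finset.mul_sum, h.sum_overlap h', mul_one]
  have h2 : (ρ * cfc Real.log σ).trace.re =
      ∑ i, ∑ j, a i * Complex.normSq ((Uᴴ * V) i j) * Real.log (b j) := by
    have e1 : (ρ * cfc Real.log σ).trace
        = ((Uᴴ * V)ᴴ * diagonal (fun i => (a i : ℂ)) * (Uᴴ * V) *
            diagonal (fun j => (Real.log (b j) : ℂ))).trace := by
      rw [h'.cfc_eq, ← Matrix.mul_assoc, trace_mul_comm, conjTranspose_mul,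
        conjTranspose_conjTranspose]
      conv_lhs => rw [h.eq_conj]
      simp only [Matrix.mul_assoc]
    rw [e1, Finset.sum_comm]
    simp only [trace, diag_apply, mul_diagonal, Complex.re_sum]
    refine Finset.sum_congr rfl fun j _ => ?_
    rw [Complex.re_mul_ofReal, mul_apply, Complex.re_sum, Finset.sum_mul]
    refine Finset.sum_congr rfl fun i _ => ?_
    rw [mul_diagonal, conjTranspose_apply]
    simp only [Complex.normSq_apply, Complex.star_def, Complex.mul_re, Complex.mul_im,
      Complex.conj_re, Complex.conj_im, Complex.ofReal_re, Complex.ofReal_im]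
    ring
  rw [relEntropy, h1, h2]
  simp only [mul_sub, Finset.sum_sub_distrib]

theorem KerLE.mul_overlap_eq_zero (hk : KerLE σ ρ) (h : IsEigendecomposition ρ U a)
    (h' : IsEigendecomposition σ V b) (i j : n) (hb : b j = 0) :
    a i * Complex.normSq ((Uᴴ * V) i j) = 0 := by
  have h1 : σ *ᵥ (fun k => V k j) = 0 := by
    ext k
    have := congrFun (congrFun h'.mul_eq k) j
    rw [mul_diagonal, hb] at this
    simpa [mulVec, dotProduct, mul_apply] using this
  have h2 : ∀ k, (ρ * V) k j = 0 := fun k => congrFun (hk _ h1) k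
  have h3 : (Uᴴ * (ρ * V)) i j = 0 := by
    rw [Matrix.mul_apply]
    simp [h2]
  rw [← Matrix.mul_assoc, h.conjTranspose_mul_eq, Matrix.mul_assoc, diagonal_mul] at h3
  rcases mul_eq_zero.1 h3 with h4 | h4
  · rw [Complex.ofReal_eq_zero.1 h4, zero_mul]
  · rw [h4, Complex.normSq_zero, mul_zero]

/-- In eigenbases of `ρ` and `σ` the resolvent form splits into independent
quadratic functions of the entries of `X`. -/
theorem resolventForm_eq_sum (h : IsEigendecomposition ρ U a) (h' : IsEigendecomposition σ V b)
    (t : ℝ) (X : Matrix n n ℂ) :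
    resolventForm t ρ σ X = ∑ i, ∑ j, (2 * (a i * ((Vᴴ * X * U) j i * (Uᴴ * V) i j).re)
      - (b j + t * a i) * Complex.normSq ((Vᴴ * X * U) j i)) := by
  set Y := Vᴴ * X * U with hY
  have hX : X = V * Y * Uᴴ := by
    rw [hY]
    have : V * (Vᴴ * X * U) * Uᴴ = (V * Vᴴ) * X * (U * Uᴴ) := by simp only [Matrix.mul_assoc]
    rw [this, h.mul_conjTranspose, h'.mul_conjTranspose, Matrix.one_mul, Matrix.mul_one]
  clear_value Y
  have h1 : (Xᴴ * ρ).trace.re = ∑ i, ∑ j, a i * (Y j i * (Uᴴ * V) i j).re := by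
    have e1 : (Xᴴ * ρ).trace = star ((diagonal (fun i => (a i : ℂ)) * (Uᴴ * V) * Y).trace) := by
      rw [← trace_conjTranspose, conjTranspose_mul, conjTranspose_mul, conjTranspose_mul,
        conjTranspose_conjTranspose, diagonal_conjTranspose, hX]
      conv_lhs => rw [h.eq_conj, trace_mul_comm]
      have e2 : (star fun i => (a i : ℂ)) = fun i => (a i : ℂ) := by ext i; simp
      rw [e2, conjTranspose_mul, conjTranspose_mul, conjTranspose_conjTranspose]
      have e3 : U * diagonal (fun i => (a i : ℂ)) * Uᴴ * (U * (Yᴴ * Vᴴ))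
          = U * diagonal (fun i => (a i : ℂ)) * (Uᴴ * U) * (Yᴴ * Vᴴ) := by
        simp only [Matrix.mul_assoc]
      rw [e3, h.conjTranspose_mul, Matrix.mul_one, Matrix.mul_assoc, trace_mul_comm]
      rw [show diagonal (fun i => (a i : ℂ)) * (Yᴴ * Vᴴ) * U
        = diagonal (fun i => (a i : ℂ)) * (Yᴴ * (Vᴴ * U)) by simp only [Matrix.mul_assoc],
        trace_mul_comm, Matrix.mul_assoc]
    rw [e1, Complex.star_def, Complex.conj_re]
    simp only [trace, diag_apply, Complex.re_sum]
    refine Finset.sum_congr rfl fun i _ => ?_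
    rw [Matrix.mul_assoc, diagonal_mul, Complex.re_ofReal_mul, mul_apply, Complex.re_sum,
      Finset.mul_sum]
    refine Finset.sum_congr rfl fun j _ => ?_
    rw [mul_comm (Y j i)]
  have h2 : (Xᴴ * σ * X).trace.re = ∑ i, ∑ j, b j * Complex.normSq (Y j i) := by
    rw [← trace_conjTranspose_mul_diagonal_mul]
    congr 1
    rw [hX]
    conv_lhs => rw [h'.eq_conj]
    rw [conjTranspose_mul, conjTranspose_mul, conjTranspose_conjTranspose]
    have e3 : U * (Yᴴ * Vᴴ) * (V * diagonal (fun i => (b i : ℂ)) * Vᴴ) * (V * Y * Uᴴ)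
        = U * (Yᴴ * (Vᴴ * V) * diagonal (fun i => (b i : ℂ)) * (Vᴴ * V) * Y * Uᴴ) := by
      simp only [Matrix.mul_assoc]
    rw [e3, h'.conjTranspose_mul, Matrix.mul_one, Matrix.mul_one, trace_mul_comm, Matrix.mul_assoc,
      h.conjTranspose_mul, Matrix.mul_one]
  have h3 : (X * ρ * Xᴴ).trace.re = ∑ i, ∑ j, a i * Complex.normSq (Y j i) := by
    have e4 := trace_conjTranspose_mul_diagonal_mul Yᴴ a
    rw [conjTranspose_conjTranspose, Finset.sum_comm] at e4
    simp only [conjTranspose_apply, Complex.star_def, Complex.normSq_conj] at e4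
    rw [← e4]
    congr 1
    rw [hX]
    conv_lhs => rw [h.eq_conj]
    rw [conjTranspose_mul, conjTranspose_mul, conjTranspose_conjTranspose]
    have e3 : V * Y * Uᴴ * (U * diagonal (fun i => (a i : ℂ)) * Uᴴ) * (U * (Yᴴ * Vᴴ))
        = V * (Y * (Uᴴ * U) * diagonal (fun i => (a i : ℂ)) * (Uᴴ * U) * Yᴴ * Vᴴ) := by
      simp only [Matrix.mul_assoc]
    rw [e3, h.conjTranspose_mul, Matrix.mul_one, Matrix.mul_one, trace_mul_comm, Matrix.mul_assoc,
      h'.conjTranspose_mul, Matrix.mul_one]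
  rw [resolventForm, h1, h2, h3]
  simp only [Finset.mul_sum, ← Finset.sum_sub_distrib]
  refine Finset.sum_congr rfl fun i _ => Finset.sum_congr rfl fun j _ => ?_
  ring

theorem two_mul_re_sub_le {x : ℝ} (hx : 0 < x) (y z : ℂ) (c : ℝ) :
    2 * (c * (y * z).re) - x * Complex.normSq y ≤ c ^ 2 * Complex.normSq z / x := by
  rw [le_div_iff₀ hx, Complex.mul_re, Complex.normSq_apply, Complex.normSq_apply]
  nlinarith [sq_nonneg (c * z.re - x * y.re), sq_nonneg (c * z.im + x * y.im)]

theorem resolventForm_le (h : IsEigendecomposition ρ U a) (h' : IsEigendecomposition σ V b)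
    (ha : ∀ i, 0 ≤ a i) (hb : ∀ j, 0 ≤ b j) {t : ℝ} (ht : 0 < t) (X : Matrix n n ℂ) :
    resolventForm t ρ σ X
      ≤ ∑ i, ∑ j, a i ^ 2 * Complex.normSq ((Uᴴ * V) i j) / (b j + t * a i) := by
  rw [resolventForm_eq_sum h h']
  refine Finset.sum_le_sum fun i _ => Finset.sum_le_sum fun j _ => ?_
  rcases (ha i).eq_or_lt with h0 | h0
  · rw [← h0]
    simpa using mul_nonneg (hb j) (Complex.normSq_nonneg _)
  · exact two_mul_re_sub_le (by have := hb j; positivity) _ _ _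

/-- The bound of `resolventForm_le` is attained, at `X = (L_σ + t R_ρ)⁻¹ ρ`. The junk value
`0 / 0 = 0` is the right coefficient where both eigenvalues vanish. -/
theorem exists_resolventForm_eq (h : IsEigendecomposition ρ U a) (h' : IsEigendecomposition σ V b)
    (ha : ∀ i, 0 ≤ a i) (hb : ∀ j, 0 ≤ b j) {t : ℝ} (ht : 0 < t) :
    ∃ X : Matrix n n ℂ, resolventForm t ρ σ X
      = ∑ i, ∑ j, a i ^ 2 * Complex.normSq ((Uᴴ * V) i j) / (b j + t * a i) := by
  set Y : Matrix n n ℂ := fun j i => ((a i / (b j + t * a i) : ℝ) : ℂ) * star ((Uᴴ * V) i j) with hY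
  refine ⟨V * Y * Uᴴ, ?_⟩
  rw [resolventForm_eq_sum h h']
  have e : Vᴴ * (V * Y * Uᴴ) * U = Y := by
    have : Vᴴ * (V * Y * Uᴴ) * U = (Vᴴ * V) * Y * (Uᴴ * U) := by simp only [Matrix.mul_assoc]
    rw [this, h.conjTranspose_mul, h'.conjTranspose_mul, Matrix.one_mul, Matrix.mul_one]
  rw [e]
  refine Finset.sum_congr rfl fun i _ => Finset.sum_congr rfl fun j _ => ?_
  have e1 : (Y j i * (Uᴴ * V) i j).re
      = a i / (b j + t * a i) * Complex.normSq ((Uᴴ * V) i j) := by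
    rw [hY, mul_assoc, Complex.star_def, mul_comm (starRingEnd ℂ _), Complex.mul_conj,
      ← Complex.ofReal_mul, Complex.ofReal_re]
  have e2 : Complex.normSq (Y j i)
      = (a i / (b j + t * a i)) ^ 2 * Complex.normSq ((Uᴴ * V) i j) := by
    rw [hY, Complex.normSq_mul, Complex.normSq_ofReal, Complex.star_def, Complex.normSq_conj, sq]
  rw [e1, e2]
  rcases (ha i).eq_or_lt with h0 | h0
  · simp [← h0]
  · have : b j + t * a i ≠ 0 := by have := hb j; positivity
    field_simp
    ring

/-- The relative entropy of `ρ` and `σ` is minus the mean logarithm of the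
ratios `b j / a i` of eigenvalues, with weights `a i |⟨uᵢ, vⱼ⟩|²`; the same weights compute the
maximum of the resolvent form. -/
theorem exists_weights (hρ : ρ.PosSemidef) (hσ : σ.PosSemidef) (hk : KerLE σ ρ)
    (h : IsEigendecomposition ρ U a) (h' : IsEigendecomposition σ V b) :
    ∃ w r : n × n → ℝ, (∀ p, 0 < r p) ∧ ∑ p, w p = ρ.trace.re ∧
      ∑ p, w p * Real.log (r p) = -relEntropy ρ σ ∧
      ∀ t : ℝ, 0 < t → ∑ p, w p / (r p + t)
        = ∑ i, ∑ j, a i ^ 2 * Complex.normSq ((Uᴴ * V) i j) / (b j + t * a i) := by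
  have ha := h.nonneg hρ
  have hb := h'.nonneg hσ
  -- Pairs with a vanishing eigenvalue have weight zero, so that their ratio may be set to `1`.
  refine ⟨fun p => a p.1 * Complex.normSq ((Uᴴ * V) p.1 p.2),
    fun p => if 0 < a p.1 ∧ 0 < b p.2 then b p.2 / a p.1 else 1, ?_, ?_, ?_, ?_⟩
  · intro p
    dsimp only
    split_ifs with hp
    · exact div_pos hp.2 hp.1
    · exact one_pos
  · rw [Fintype.sum_prod_type, h.trace_eq, Complex.ofReal_re]
    refine Finset.sum_congr rfl fun i _ => ?_
    dsimp only
    rw [← Finset.mul_sum, h.sum_overlap h', mul_one]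
  · rw [Fintype.sum_prod_type, relEntropy_eq_sum h h', ← Finset.sum_neg_distrib]
    refine Finset.sum_congr rfl fun i _ => ?_
    rw [← Finset.sum_neg_distrib]
    refine Finset.sum_congr rfl fun j _ => ?_
    dsimp only
    split_ifs with hp
    · rw [Real.log_div hp.2.ne' hp.1.ne']
      ring
    · have h0 : a i * Complex.normSq ((Uᴴ * V) i j) = 0 := by
        rcases (ha i).eq_or_lt with h1 | h1
        · rw [← h1, zero_mul]
        · refine hk.mul_overlap_eq_zero h h' i j ?_
          by_contra h2
          exact hp ⟨h1, (hb j).lt_of_ne' h2⟩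
      rw [h0]
      simp
  · intro t ht
    rw [Fintype.sum_prod_type]
    refine Finset.sum_congr rfl fun i _ => Finset.sum_congr rfl fun j _ => ?_
    dsimp only
    rcases (ha i).eq_or_lt with h1 | h1
    · simp [← h1]
    rcases (hb j).eq_or_lt with h2 | h2
    · have h0 := hk.mul_overlap_eq_zero h h' i j h2.symm
      rw [sq, mul_assoc, h0]
      simp
    · rw [if_pos ⟨h1, h2⟩]
      field_simp

end

/-- Relative entropies are compared by comparing the resolvent forms: the
relative entropy is a mixture of the numbers `⟨ρ, (L_σ + t R_ρ)⁻¹ ρ⟩` over `t > 0`. -/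
theorem relEntropy_le_of_resolventForm_le {n m : Type*} [Fintype n] [DecidableEq n] [Fintype m]
    [DecidableEq m] {ρ σ : Matrix n n ℂ} {ρ' σ' : Matrix m m ℂ} (hρ : ρ.PosSemidef)
    (hσ : σ.PosSemidef) (hρ' : ρ'.PosSemidef) (hσ' : σ'.PosSemidef) (hk : KerLE σ ρ)
    (hk' : KerLE σ' ρ') (htr : ρ.trace = ρ'.trace)
    (hform : ∀ t : ℝ, 0 < t → ∀ X' : Matrix m m ℂ, ∃ X : Matrix n n ℂ,
      resolventForm t ρ' σ' X' ≤ resolventForm t ρ σ X) :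
    relEntropy ρ' σ' ≤ relEntropy ρ σ := by
  have dρ := IsEigendecomposition.of_isHermitian hρ.1
  have dσ := IsEigendecomposition.of_isHermitian hσ.1
  have dρ' := IsEigendecomposition.of_isHermitian hρ'.1
  have dσ' := IsEigendecomposition.of_isHermitian hσ'.1
  obtain ⟨w, r, hr, hw, hlog, hres⟩ := exists_weights hρ hσ hk dρ dσ
  obtain ⟨w', r', hr', hw', hlog', hres'⟩ := exists_weights hρ' hσ' hk' dρ' dσ'
  have key := sum_log_le_of_resolvent_le hr hr' (by rw [hw, hw', htr]) fun t ht => by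
    rw [hres t ht, hres' t ht]
    obtain ⟨X', hX'⟩ := exists_resolventForm_eq dρ' dσ' (dρ'.nonneg hρ') (dσ'.nonneg hσ') ht
    obtain ⟨X, hX⟩ := hform t ht X'
    rw [← hX']
    exact hX.trans (resolventForm_le dρ dσ (dρ.nonneg hρ) (dσ.nonneg hσ) ht X)
  rw [hlog, hlog'] at key
  linarith

/-! ### Data processing -/

section

variable {n m κ : Type*} [Fintype n] [DecidableEq n] [Fintype m] [DecidableEq m] [Fintype κ]

/-- The completely positive map with Kraus operators `K k`. -/
noncomputable def krausMap (K : κ → Matrix m n ℂ) (ρ : Matrix n n ℂ) : Matrix m m ℂ :=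
  ∑ k, K k * ρ * (K k)ᴴ

theorem krausMap_posSemidef (K : κ → Matrix m n ℂ) {ρ : Matrix n n ℂ} (hρ : ρ.PosSemidef) :
    (krausMap K ρ).PosSemidef :=
  posSemidef_sum _ fun k _ => hρ.mul_mul_conjTranspose_same (K k)

theorem trace_krausMap {K : κ → Matrix m n ℂ} (hK : ∑ k, (K k)ᴴ * K k = 1) (ρ : Matrix n n ℂ) :
    (krausMap K ρ).trace = ρ.trace := by
  rw [krausMap, trace_sum]
  have : ∀ k, (K k * ρ * (K k)ᴴ).trace = ((K k)ᴴ * K k * ρ).trace := fun k => by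
    rw [trace_mul_comm, Matrix.mul_assoc]
  simp only [this]
  rw [← trace_sum, ← Finset.sum_mul, hK, Matrix.one_mul]

theorem IsState.krausMap {K : κ → Matrix m n ℂ} (hK : ∑ k, (K k)ᴴ * K k = 1) {ρ : Matrix n n ℂ}
    (hρ : IsState ρ) : IsState (krausMap K ρ) :=
  ⟨krausMap_posSemidef K hρ.1, by rw [trace_krausMap hK, hρ.2]⟩

theorem KerLE.add_left {ρ σ : Matrix n n ℂ} (hρ : ρ.PosSemidef) (hσ : σ.PosSemidef) :
    KerLE (ρ + σ) ρ := by
  intro v hv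
  have h1 : star v ⬝ᵥ (ρ + σ) *ᵥ v = 0 := by rw [hv, dotProduct_zero]
  rw [add_mulVec, dotProduct_add] at h1
  have h2 := hρ.dotProduct_mulVec_nonneg v
  have h3 := hσ.dotProduct_mulVec_nonneg v
  exact (hρ.dotProduct_mulVec_zero_iff v).1 ((add_eq_zero_iff_of_nonneg h2 h3).1 h1).1

theorem KerLE.krausMap {ρ σ : Matrix n n ℂ} (hσ : σ.PosSemidef) (h : KerLE σ ρ)
    (K : κ → Matrix m n ℂ) : KerLE (krausMap K σ) (krausMap K ρ) := by
  intro v hv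
  have h1 : star v ⬝ᵥ (QInfo.krausMap K σ) *ᵥ v = 0 := by rw [hv, dotProduct_zero]
  rw [QInfo.krausMap, sum_mulVec, dotProduct_sum] at h1
  have h2 : ∀ k ∈ Finset.univ, 0 ≤ star v ⬝ᵥ (K k * σ * (K k)ᴴ) *ᵥ v := fun k _ =>
    (hσ.mul_mul_conjTranspose_same (K k)).dotProduct_mulVec_nonneg v
  rw [QInfo.krausMap, sum_mulVec]
  refine Finset.sum_eq_zero fun k _ => ?_
  have h3 := (Finset.sum_eq_zero_iff_of_nonneg h2).1 h1 k (Finset.mem_univ k)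
  have h4 : star ((K k)ᴴ *ᵥ v) ⬝ᵥ σ *ᵥ ((K k)ᴴ *ᵥ v) = 0 := by
    rw [← h3, star_mulVec, conjTranspose_conjTranspose, ← dotProduct_mulVec, mulVec_mulVec,
      mulVec_mulVec, Matrix.mul_assoc]
  have h5 := h _ ((hσ.dotProduct_mulVec_zero_iff _).1 h4)
  rw [Matrix.mul_assoc, ← mulVec_mulVec, ← mulVec_mulVec, h5, mulVec_zero]

/-- The Kadison–Schwarz inequality for the adjoint `X ↦ ∑ k, Kₖᴴ X Kₖ` of a channel,
paired with `σ ≥ 0`. The gap is `∑ k, Tr (Zₖ σ Zₖᴴ)` for `Zₖ = Xᴴ Kₖ - Kₖ (∑ l, Kₗᴴ X Kₗ)ᴴ`. -/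
theorem trace_kadison_schwarz {K : κ → Matrix m n ℂ} (hK : ∑ k, (K k)ᴴ * K k = 1)
    {σ : Matrix n n ℂ} (hσ : σ.PosSemidef) (X : Matrix m m ℂ) :
    ((∑ k, (K k)ᴴ * X * K k)ᴴ * σ * ∑ k, (K k)ᴴ * X * K k).trace.re
      ≤ (Xᴴ * krausMap K σ * X).trace.re := by
  set Y := ∑ k, (K k)ᴴ * X * K k with hY
  have hY' : Yᴴ = ∑ k, (K k)ᴴ * Xᴴ * K k := by
    rw [hY, conjTranspose_sum]
    refine Finset.sum_congr rfl fun k _ => ?_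
    rw [conjTranspose_mul, conjTranspose_mul, conjTranspose_conjTranspose, Matrix.mul_assoc]
  have hnn : 0 ≤ (∑ k, ((Xᴴ * K k - K k * Yᴴ) * σ * (Xᴴ * K k - K k * Yᴴ)ᴴ).trace).re := by
    have : (0 : ℂ) ≤ ∑ k, ((Xᴴ * K k - K k * Yᴴ) * σ * (Xᴴ * K k - K k * Yᴴ)ᴴ).trace :=
      Finset.sum_nonneg fun k _ => (hσ.mul_mul_conjTranspose_same _).trace_nonneg
    exact (Complex.le_def.1 this).1
  have hterm : ∀ k, ((Xᴴ * K k - K k * Yᴴ) * σ * (Xᴴ * K k - K k * Yᴴ)ᴴ).trace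
      = (Xᴴ * (K k * σ * (K k)ᴴ) * X).trace - ((K k)ᴴ * Xᴴ * K k * (σ * Y)).trace
        - (Yᴴ * σ * ((K k)ᴴ * X * K k)).trace + ((K k)ᴴ * K k * (Yᴴ * σ * Y)).trace := by
    intro k
    rw [conjTranspose_sub, conjTranspose_mul, conjTranspose_mul, conjTranspose_conjTranspose,
      conjTranspose_conjTranspose, Matrix.sub_mul, Matrix.sub_mul, Matrix.mul_sub, Matrix.mul_sub,
      trace_sub, trace_sub, trace_sub]
    have e1 : (Xᴴ * K k * σ * ((K k)ᴴ * X)).trace = (Xᴴ * (K k * σ * (K k)ᴴ) * X).trace := by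
      simp only [Matrix.mul_assoc]
    have e2 : (Xᴴ * K k * σ * (Y * (K k)ᴴ)).trace
        = ((K k)ᴴ * Xᴴ * K k * (σ * Y)).trace := by
      rw [← Matrix.mul_assoc, trace_mul_comm]
      simp only [Matrix.mul_assoc]
    have e3 : (K k * Yᴴ * σ * ((K k)ᴴ * X)).trace = (Yᴴ * σ * ((K k)ᴴ * X * K k)).trace := by
      rw [Matrix.mul_assoc, Matrix.mul_assoc, trace_mul_comm]
      simp only [Matrix.mul_assoc]
    have e4 : (K k * Yᴴ * σ * (Y * (K k)ᴴ)).trace = ((K k)ᴴ * K k * (Yᴴ * σ * Y)).trace := by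
      rw [← Matrix.mul_assoc, trace_mul_comm]
      simp only [Matrix.mul_assoc]
    rw [e1, e2, e3, e4]
    ring
  have hsum : ∑ k, ((Xᴴ * K k - K k * Yᴴ) * σ * (Xᴴ * K k - K k * Yᴴ)ᴴ).trace
      = (Xᴴ * krausMap K σ * X).trace - (Yᴴ * σ * Y).trace := by
    simp only [hterm]
    rw [Finset.sum_add_distrib, Finset.sum_sub_distrib, Finset.sum_sub_distrib, ← trace_sum,
      ← trace_sum, ← trace_sum, ← trace_sum, ← Finset.sum_mul, ← Finset.sum_mul, ← Finset.mul_sum,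
      ← Finset.sum_mul, ← Finset.mul_sum, hK, ← hY, ← hY', Matrix.one_mul, krausMap,
      ← Matrix.mul_assoc]
    ring
  rw [hsum, Complex.sub_re] at hnn
  linarith

/-- The data-processing inequality. -/
theorem relEntropy_krausMap_le {K : κ → Matrix m n ℂ} (hK : ∑ k, (K k)ᴴ * K k = 1)
    {ρ σ : Matrix n n ℂ} (hρ : ρ.PosSemidef) (hσ : σ.PosSemidef) (hk : KerLE σ ρ) :
    relEntropy (krausMap K ρ) (krausMap K σ) ≤ relEntropy ρ σ := by
  refine relEntropy_le_of_resolventForm_le hρ hσ (krausMap_posSemidef K hρ)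
    (krausMap_posSemidef K hσ) hk (hk.krausMap hσ K) (trace_krausMap hK ρ).symm fun t ht X => ?_
  refine ⟨∑ k, (K k)ᴴ * X * K k, ?_⟩
  have hadj : ∀ X : Matrix m m ℂ, (∑ k, (K k)ᴴ * X * K k)ᴴ = ∑ k, (K k)ᴴ * Xᴴ * K k := fun X => by
    rw [conjTranspose_sum]
    refine Finset.sum_congr rfl fun k _ => ?_
    rw [conjTranspose_mul, conjTranspose_mul, conjTranspose_conjTranspose, Matrix.mul_assoc]
  have h1 : ((∑ k, (K k)ᴴ * X * K k)ᴴ * ρ).trace = (Xᴴ * krausMap K ρ).trace := by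
    rw [hadj, krausMap, Finset.sum_mul, Finset.mul_sum, trace_sum, trace_sum]
    refine Finset.sum_congr rfl fun k _ => ?_
    rw [Matrix.mul_assoc, Matrix.mul_assoc, trace_mul_comm]
    simp only [Matrix.mul_assoc]
  have h2 := trace_kadison_schwarz hK hσ X
  have h3 := trace_kadison_schwarz hK hρ Xᴴ
  rw [hadj, conjTranspose_conjTranspose, ← hadj] at h3
  rw [resolventForm, resolventForm, h1]
  have := mul_le_mul_of_nonneg_left h3 ht.le
  linarith

theorem relEntropy_self (ρ : Matrix n n ℂ) : relEntropy ρ ρ = 0 := sub_self _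

/-- The relative entropy is antitone in the second argument, since the resolvent form is;
here the first argument is compared with itself. -/
theorem relEntropy_add_right_le {ρ σ : Matrix n n ℂ} (hρ : ρ.PosSemidef) (hσ : σ.PosSemidef) :
    relEntropy ρ (ρ + σ) ≤ 0 := by
  rw [← relEntropy_self ρ]
  refine relEntropy_le_of_resolventForm_le hρ hρ hρ (hρ.add hσ) (fun _ h => h)
    (KerLE.add_left hρ hσ) rfl fun t ht X => ⟨X, ?_⟩
  have h1 := (Complex.le_def.1 (hσ.conjTranspose_mul_mul_same X).trace_nonneg).1
  rw [resolventForm, resolventForm, Matrix.mul_add, Matrix.add_mul, trace_add, Complex.add_re]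
  simp only [Complex.zero_re] at h1
  linarith

/-- Klein's inequality: data processing for the channel `ρ ↦ Tr ρ`. -/
theorem le_relEntropy {ρ σ : Matrix n n ℂ} (hρ : ρ.PosSemidef) (hσ : σ.PosSemidef)
    (hk : KerLE σ ρ) :
    ρ.trace.re * (Real.log ρ.trace.re - Real.log σ.trace.re) ≤ relEntropy ρ σ := by
  set K : n → Matrix Unit n ℂ := fun i => Matrix.single () i 1
  have hK : ∑ i, (K i)ᴴ * K i = 1 := by
    simp only [K, conjTranspose_single, star_one, single_mul_single_same, mul_one]
    exact sum_single_one
  have hdec : ∀ {τ : Matrix n n ℂ}, τ.PosSemidef →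
      IsEigendecomposition (krausMap K τ) 1 (fun _ => τ.trace.re) := fun {τ} hτ =>
    { conjTranspose_mul := by simp
      mul_conjTranspose := by simp
      eq_conj := by
        have h1 := trace_krausMap hK τ
        have h2 := (Complex.le_def.1 hτ.trace_nonneg).2
        ext i j
        rw [conjTranspose_one, Matrix.one_mul, Matrix.mul_one, Subsingleton.elim j i,
          diagonal_apply_eq]
        have h3 : krausMap K τ i i = τ.trace := by
          rw [← h1]
          simp [trace]
        rw [h3]
        exact Complex.ext (by simp) (by simpa using h2.symm) }
  refine le_trans (le_of_eq ?_) (relEntropy_krausMap_le hK hρ hσ hk)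
  rw [relEntropy_eq_sum (hdec hρ) (hdec hσ)]
  simp

/-! ### Entropy estimates -/

theorem trace_mul_log {ρ : Matrix n n ℂ} (hρ : ρ.IsHermitian) :
    (ρ * cfc Real.log ρ).trace.re = -(entropy ρ * Real.log 2) := by
  have h := IsEigendecomposition.of_isHermitian hρ
  generalize (hρ.eigenvectorUnitary : Matrix n n ℂ) = U at h
  have e1 : ρ * cfc Real.log ρ = U * diagonal (fun i =>
      (hρ.eigenvalues i : ℂ) * (Real.log (hρ.eigenvalues i) : ℂ)) * Uᴴ := by
    conv_lhs => rw [h.cfc_eq, ← Matrix.mul_assoc, ← Matrix.mul_assoc, h.mul_eq,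
      Matrix.mul_assoc U, diagonal_mul_diagonal]
  rw [e1, h.trace_conj, Complex.re_sum, h.entropy_eq,
    div_mul_cancel₀ _ (Real.log_pos one_lt_two).ne', ← Finset.sum_neg_distrib]
  refine Finset.sum_congr rfl fun i _ => ?_
  rw [← Complex.ofReal_mul, Complex.ofReal_re, Real.negMulLog]
  ring

theorem entropy_nonneg {ρ : Matrix n n ℂ} (hρ : ρ.PosSemidef) (htr : ρ.trace.re ≤ 1) :
    0 ≤ entropy ρ := by
  have h := IsEigendecomposition.of_isHermitian hρ.1
  have ha := h.nonneg hρ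
  rw [h.trace_eq, Complex.ofReal_re] at htr
  rw [h.entropy_eq]
  refine div_nonneg (Finset.sum_nonneg fun i _ => Real.negMulLog_nonneg (ha i) ?_)
    (Real.log_nonneg one_le_two)
  exact (Finset.single_le_sum (fun j _ => ha j) (Finset.mem_univ i)).trans htr

theorem entropy_mul_log_two_le {ρ : Matrix n n ℂ} (hρ : ρ.PosSemidef) :
    entropy ρ * Real.log 2
      ≤ ρ.trace.re * Real.log (Fintype.card n) + Real.negMulLog ρ.trace.re := by
  have h1 := le_relEntropy hρ PosSemidef.one (fun v hv => by
    rw [one_mulVec] at hv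
    rw [hv, mulVec_zero])
  have h2 : (ρ * cfc Real.log (1 : Matrix n n ℂ)).trace.re = 0 := by
    have h : IsEigendecomposition (1 : Matrix n n ℂ) 1 (fun _ => 1) :=
      ⟨by simp, by simp, by simp⟩
    rw [h.cfc_eq]
    simp
  rw [relEntropy, trace_mul_log hρ.1, h2, trace_one, Complex.natCast_re] at h1
  rw [Real.negMulLog]
  linarith

/-- One-sided continuity of the entropy. If `ω = ρ + B = σ + C`, then concavity bounds `S(ω)` from
below by `S(ρ) + S(B)` and subadditivity over sums bounds it from above by `S(σ) + S(C)`, up to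
terms that only depend on the traces. -/
theorem entropy_mul_log_two_le_add {ρ σ B C : Matrix n n ℂ} (hρ : IsState ρ) (hσ : IsState σ)
    (hB : B.PosSemidef) (hC : C.PosSemidef) (h : ρ + B = σ + C) (hB1 : B.trace.re ≤ 1) :
    entropy ρ * Real.log 2
      ≤ entropy σ * Real.log 2 + C.trace.re * Real.log (Fintype.card n) + 4 := by
  have htr : B.trace.re = C.trace.re := by
    have := congrArg (fun M => (Matrix.trace M).re) h
    simp only [trace_add, hρ.2, hσ.2, Complex.add_re] at this
    linarith
  have hε : 0 ≤ C.trace.re := (Complex.le_def.1 hC.trace_nonneg).1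
  have hC1 := entropy_mul_log_two_le hC
  have hB2 := mul_nonneg (entropy_nonneg hB hB1) (Real.log_nonneg one_le_two)
  have k1 := le_relEntropy hρ.1 (hρ.1.add hB) (KerLE.add_left hρ.1 hB)
  have k2 := le_relEntropy hB (hρ.1.add hB) (by rw [add_comm]; exact KerLE.add_left hB hρ.1)
  have k3 := relEntropy_add_right_le hσ.1 hC
  have k4 := relEntropy_add_right_le hC hσ.1
  rw [add_comm C σ] at k4
  rw [trace_add, hρ.2, Complex.add_re, Complex.one_re, Real.log_one] at k1
  rw [trace_add, hρ.2, Complex.add_re, Complex.one_re] at k2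
  rw [relEntropy, trace_mul_log hρ.1.1] at k1
  rw [relEntropy, trace_mul_log hB.1] at k2
  rw [relEntropy, trace_mul_log hσ.1.1] at k3
  rw [relEntropy, trace_mul_log hC.1] at k4
  have e1 : (ρ * cfc Real.log (ρ + B)).trace.re + (B * cfc Real.log (ρ + B)).trace.re
      = (σ * cfc Real.log (σ + C)).trace.re + (C * cfc Real.log (σ + C)).trace.re := by
    rw [← Complex.add_re, ← Complex.add_re, ← trace_add, ← trace_add, ← Matrix.add_mul,
      ← Matrix.add_mul, h]
  rw [htr] at k1 k2 hB1
  set ε := C.trace.re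
  have b1 : Real.log (1 + ε) ≤ ε := by
    have := Real.log_le_sub_one_of_pos (show 0 < 1 + ε by positivity)
    linarith
  have b2 : (1 + ε) * Real.log (1 + ε) ≤ 2 := by nlinarith
  have b3 : Real.negMulLog ε ≤ 1 := by
    rcases hε.eq_or_lt with h0 | h0
    · rw [← h0]; simp
    · have h1 := Real.log_le_sub_one_of_pos (inv_pos.2 h0)
      rw [Real.log_inv] at h1
      rw [Real.negMulLog]
      have h2 := mul_le_mul_of_nonneg_left h1 hε
      have h3 : ε * ε⁻¹ = 1 := mul_inv_cancel₀ h0.ne'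
      nlinarith
  rw [Real.negMulLog] at b3 hC1
  nlinarith

end

/-! ### Mutual information and local channels -/

section

variable {X Y Y' κ : Type*} [Fintype X] [DecidableEq X] [Fintype Y] [DecidableEq Y]
  [Fintype Y'] [DecidableEq Y'] [Fintype κ]

theorem traceSnd_posSemidef {ρ : Matrix (X × Y) (X × Y) ℂ} (hρ : ρ.PosSemidef) :
    (traceSnd ρ).PosSemidef := by
  have : traceSnd ρ = ∑ y, ρ.submatrix (fun x => (x, y)) (fun x => (x, y)) := by
    ext x x'
    simp [traceSnd, Matrix.sum_apply]
  rw [this]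
  exact posSemidef_sum _ fun y _ => hρ.submatrix _

theorem traceFst_posSemidef {ρ : Matrix (X × Y) (X × Y) ℂ} (hρ : ρ.PosSemidef) :
    (traceFst ρ).PosSemidef := by
  have : traceFst ρ = ∑ x, ρ.submatrix (fun y => (x, y)) (fun y => (x, y)) := by
    ext x x'
    simp [traceFst, Matrix.sum_apply]
  rw [this]
  exact posSemidef_sum _ fun y _ => hρ.submatrix _

theorem trace_traceSnd (ρ : Matrix (X × Y) (X × Y) ℂ) : (traceSnd ρ).trace = ρ.trace := by
  simp [trace, traceSnd, Fintype.sum_prod_type]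

theorem trace_traceFst (ρ : Matrix (X × Y) (X × Y) ℂ) : (traceFst ρ).trace = ρ.trace := by
  simp only [trace, traceFst, Fintype.sum_prod_type, diag_apply]
  exact Finset.sum_comm

theorem IsState.traceSnd {ρ : Matrix (X × Y) (X × Y) ℂ} (hρ : IsState ρ) :
    IsState (traceSnd ρ) :=
  ⟨traceSnd_posSemidef hρ.1, by rw [trace_traceSnd, hρ.2]⟩

theorem IsState.traceFst {ρ : Matrix (X × Y) (X × Y) ℂ} (hρ : IsState ρ) :
    IsState (traceFst ρ) :=
  ⟨traceFst_posSemidef hρ.1, by rw [trace_traceFst, hρ.2]⟩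

theorem trace_mul_kronecker_one (ρ : Matrix (X × Y) (X × Y) ℂ) (M : Matrix X X ℂ) :
    (ρ * (M ⊗ₖ (1 : Matrix Y Y ℂ))).trace = (traceSnd ρ * M).trace := by
  simp only [trace, diag_apply, Matrix.mul_apply, traceSnd, Fintype.sum_prod_type,
    kroneckerMap_apply, one_apply, mul_ite, mul_one, mul_zero, Finset.sum_ite_eq',
    Finset.mem_univ, if_true, Finset.sum_mul]
  refine Finset.sum_congr rfl fun x _ => ?_
  exact Finset.sum_comm

theorem trace_mul_one_kronecker (ρ : Matrix (X × Y) (X × Y) ℂ) (M : Matrix Y Y ℂ) :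
    (ρ * ((1 : Matrix X X ℂ) ⊗ₖ M)).trace = (traceFst ρ * M).trace := by
  simp only [trace, diag_apply, Matrix.mul_apply, traceFst, Fintype.sum_prod_type,
    kroneckerMap_apply, one_apply, ite_mul, one_mul, zero_mul, mul_ite, mul_zero,
    Finset.sum_mul]
  rw [Finset.sum_comm]
  refine Finset.sum_congr rfl fun y _ => ?_
  rw [Finset.sum_comm]
  conv_rhs => rw [Finset.sum_comm]
  rw [Finset.sum_comm]
  refine Finset.sum_congr rfl fun x _ => ?_
  rw [Finset.sum_comm]
  simp

/-- If `u` is in the kernel of the marginal `ρ^X`, then the sum over `y` of the numbers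
`⟨u ⊗ y, ρ (u ⊗ y)⟩ ≥ 0` vanishes, hence so does each `ρ (u ⊗ y)`. -/
theorem mulVec_eq_zero_of_traceSnd {ρ : Matrix (X × Y) (X × Y) ℂ} (hρ : ρ.PosSemidef)
    {u : X → ℂ} (hu : traceSnd ρ *ᵥ u = 0) (v : Y → ℂ) :
    ρ *ᵥ (fun p => u p.1 * v p.2) = 0 := by
  set e : Y → X × Y → ℂ := fun y p => u p.1 * if p.2 = y then 1 else 0 with he
  have h1 : ∑ y, star (e y) ⬝ᵥ ρ *ᵥ (e y) = 0 := by
    have h2 : star u ⬝ᵥ traceSnd ρ *ᵥ u = 0 := by rw [hu, dotProduct_zero]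
    rw [← h2]
    have h5 : ∀ y x y', (ρ *ᵥ (e y)) (x, y') = ∑ x', ρ (x, y') (x', y) * u x' := fun y x y' => by
      simp [he, mulVec, dotProduct, Fintype.sum_prod_type]
    have h6 : ∀ y, star (e y) ⬝ᵥ ρ *ᵥ (e y)
        = ∑ x, star (u x) * ∑ x', ρ (x, y) (x', y) * u x' := fun y => by
      simp only [dotProduct, Fintype.sum_prod_type, h5, Pi.star_apply]
      refine Finset.sum_congr rfl fun x _ => ?_
      simp [he, apply_ite star]
    simp only [h6]
    rw [Finset.sum_comm]
    refine Finset.sum_congr rfl fun x _ => ?_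
    rw [← Finset.mul_sum, Pi.star_apply, mulVec, dotProduct, Finset.sum_comm]
    simp only [traceSnd, Finset.sum_mul]
  have h3 : ∀ y, ρ *ᵥ (e y) = 0 := fun y =>
    (hρ.dotProduct_mulVec_zero_iff _).1 ((Finset.sum_eq_zero_iff_of_nonneg
      fun y _ => hρ.dotProduct_mulVec_nonneg (e y)).1 h1 y (Finset.mem_univ y))
  have h4 : (fun p : X × Y => u p.1 * v p.2) = ∑ y, v y • e y := by
    ext p
    simp [he, Finset.sum_apply, mul_comm]
  rw [h4, mulVec_sum]
  refine Finset.sum_eq_zero fun y _ => ?_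
  rw [mulVec_smul, h3, smul_zero]

theorem mulVec_eq_zero_of_traceFst {ρ : Matrix (X × Y) (X × Y) ℂ} (hρ : ρ.PosSemidef)
    {v : Y → ℂ} (hv : traceFst ρ *ᵥ v = 0) (u : X → ℂ) :
    ρ *ᵥ (fun p => u p.1 * v p.2) = 0 := by
  have h1 := mulVec_eq_zero_of_traceSnd (hρ.submatrix (Prod.swap : Y × X → X × Y)) (u := v) hv u
  ext p
  have h2 := congrFun h1 p.swap
  rw [Pi.zero_apply] at h2 ⊢
  rw [← h2, mulVec, mulVec, dotProduct, dotProduct]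
  refine Fintype.sum_equiv (Equiv.prodComm X Y) _ _ fun q => ?_
  simp [mul_comm]

/-- In a product eigenbasis of the marginals, `ρ` annihilates the vectors with
eigenvalue zero. -/
theorem mul_kronecker_apply_eq_zero {ρ : Matrix (X × Y) (X × Y) ℂ} (hρ : ρ.PosSemidef)
    {U : Matrix X X ℂ} {a : X → ℝ} {V : Matrix Y Y ℂ} {b : Y → ℝ}
    (hU : IsEigendecomposition (traceSnd ρ) U a) (hV : IsEigendecomposition (traceFst ρ) V b)
    {q : X × Y} (hq : a q.1 * b q.2 = 0) (p : X × Y) : (ρ * (U ⊗ₖ V)) p q = 0 := by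
  have key : ρ *ᵥ (fun r => U r.1 q.1 * V r.2 q.2) = 0 := by
    rcases mul_eq_zero.1 hq with h | h
    · refine mulVec_eq_zero_of_traceSnd hρ (u := fun x => U x q.1) ?_ (fun y => V y q.2)
      ext x
      have := congrFun (congrFun hU.mul_eq x) q.1
      rw [mul_diagonal, h] at this
      simpa [mulVec, dotProduct, Matrix.mul_apply] using this
    · refine mulVec_eq_zero_of_traceFst hρ (v := fun x => V x q.2) ?_ (fun y => U y q.1)
      ext x
      have := congrFun (congrFun hV.mul_eq x) q.2
      rw [mul_diagonal, h] at this
      simpa [mulVec, dotProduct, Matrix.mul_apply] using this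
  exact congrFun key p

theorem KerLE.marginals {ρ : Matrix (X × Y) (X × Y) ℂ} (hρ : ρ.PosSemidef) :
    KerLE (traceSnd ρ ⊗ₖ traceFst ρ) ρ := by
  intro v hv
  have hU := IsEigendecomposition.of_isHermitian (traceSnd_posSemidef hρ).1
  have hV := IsEigendecomposition.of_isHermitian (traceFst_posSemidef hρ).1
  have hW := hU.kronecker hV
  have hz := fun p q hq => mul_kronecker_apply_eq_zero hρ hU hV (q := q) hq p
  set W := ((traceSnd_posSemidef hρ).1.eigenvectorUnitary : Matrix X X ℂ) ⊗ₖ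
    ((traceFst_posSemidef hρ).1.eigenvectorUnitary : Matrix Y Y ℂ)
  have h1 : ∀ q, (((traceSnd_posSemidef hρ).1.eigenvalues q.1 *
      (traceFst_posSemidef hρ).1.eigenvalues q.2 : ℝ) : ℂ) * (Wᴴ *ᵥ v) q = 0 := by
    intro q
    have h2 : (Wᴴ * (traceSnd ρ ⊗ₖ traceFst ρ)) *ᵥ v = 0 := by
      rw [← mulVec_mulVec, hv, mulVec_zero]
    rw [hW.conjTranspose_mul_eq, ← mulVec_mulVec] at h2
    have h3 := congrFun h2 q
    rwa [mulVec_diagonal] at h3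
  have h4 : ρ *ᵥ v = (ρ * W) *ᵥ (Wᴴ *ᵥ v) := by
    rw [mulVec_mulVec, Matrix.mul_assoc, hW.mul_conjTranspose, Matrix.mul_one]
  rw [h4]
  ext p
  rw [mulVec, dotProduct]
  refine Finset.sum_eq_zero fun q _ => ?_
  rcases mul_eq_zero.1 (h1 q) with h5 | h5
  · rw [hz p q (Complex.ofReal_eq_zero.1 h5), zero_mul]
  · rw [h5, mul_zero]

/-- `log (ρ^X ⊗ ρ^Y) = log ρ^X ⊗ 1 + 1 ⊗ log ρ^Y` on the support of `ρ`. -/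
theorem mul_log_marginals {ρ : Matrix (X × Y) (X × Y) ℂ} (hρ : ρ.PosSemidef) :
    ρ * cfc Real.log (traceSnd ρ ⊗ₖ traceFst ρ)
      = ρ * (cfc Real.log (traceSnd ρ) ⊗ₖ (1 : Matrix Y Y ℂ))
        + ρ * ((1 : Matrix X X ℂ) ⊗ₖ cfc Real.log (traceFst ρ)) := by
  have hU := IsEigendecomposition.of_isHermitian (traceSnd_posSemidef hρ).1
  have hV := IsEigendecomposition.of_isHermitian (traceFst_posSemidef hρ).1
  generalize ((traceSnd_posSemidef hρ).1.eigenvectorUnitary : Matrix X X ℂ) = U at hU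
  generalize ((traceFst_posSemidef hρ).1.eigenvectorUnitary : Matrix Y Y ℂ) = V at hV
  generalize (traceSnd_posSemidef hρ).1.eigenvalues = a at hU
  generalize (traceFst_posSemidef hρ).1.eigenvalues = b at hV
  have hW := hU.kronecker hV
  have hz := fun p q hq => mul_kronecker_apply_eq_zero hρ hU hV (q := q) hq p
  have e1 : (ρ * (U ⊗ₖ V)) * diagonal (fun q => (Real.log (a q.1 * b q.2) : ℂ))
      = (ρ * (U ⊗ₖ V)) * (diagonal (fun i => (Real.log (a i) : ℂ)) ⊗ₖ 1
        + 1 ⊗ₖ diagonal (fun j => (Real.log (b j) : ℂ))) := by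
    have e2 : diagonal (fun i => (Real.log (a i) : ℂ)) ⊗ₖ (1 : Matrix Y Y ℂ)
        + (1 : Matrix X X ℂ) ⊗ₖ diagonal (fun j => (Real.log (b j) : ℂ))
        = diagonal (fun q : X × Y => (Real.log (a q.1) : ℂ) + Real.log (b q.2)) := by
      rw [← diagonal_one, ← diagonal_one, diagonal_kronecker_diagonal, diagonal_kronecker_diagonal,
        diagonal_add]
      simp
    rw [e2]
    ext p q
    rw [mul_diagonal, mul_diagonal]
    by_cases hq : a q.1 * b q.2 = 0
    · rw [hz p q hq, zero_mul, zero_mul]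
    · rw [Real.log_mul (left_ne_zero_of_mul hq) (right_ne_zero_of_mul hq)]
      push_cast
      rfl
  have e3 : (U ⊗ₖ V) * (diagonal (fun i => (Real.log (a i) : ℂ)) ⊗ₖ 1) * (U ⊗ₖ V)ᴴ
      = cfc Real.log (traceSnd ρ) ⊗ₖ 1 := by
    rw [hU.cfc_eq, conjTranspose_kronecker, ← mul_kronecker_mul, ← mul_kronecker_mul,
      Matrix.mul_one, hV.mul_conjTranspose]
  have e4 : (U ⊗ₖ V) * (1 ⊗ₖ diagonal (fun i => (Real.log (b i) : ℂ))) * (U ⊗ₖ V)ᴴ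
      = 1 ⊗ₖ cfc Real.log (traceFst ρ) := by
    rw [hV.cfc_eq, conjTranspose_kronecker, ← mul_kronecker_mul, ← mul_kronecker_mul,
      Matrix.mul_one, hU.mul_conjTranspose]
  rw [← e3, ← e4, hW.cfc_eq, ← Matrix.mul_assoc, ← Matrix.mul_assoc, e1]
  simp only [Matrix.mul_assoc, Matrix.mul_add, Matrix.add_mul]

/-- The mutual information is the relative entropy to the product of the marginals. -/
theorem mutualInfo_mul_log_two {ρ : Matrix (X × Y) (X × Y) ℂ} (hρ : ρ.PosSemidef) :
    mutualInfo ρ * Real.log 2 = relEntropy ρ (traceSnd ρ ⊗ₖ traceFst ρ) := by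
  rw [relEntropy, mul_log_marginals hρ, trace_add, trace_mul_kronecker_one,
    trace_mul_one_kronecker, Complex.add_re, trace_mul_log (traceSnd_posSemidef hρ).1,
    trace_mul_log (traceFst_posSemidef hρ).1, trace_mul_log hρ.1, mutualInfo]
  ring

/-- The map on `X × Y` that applies the map with Kraus operators `L k` to the second system. -/
noncomputable def localMap (L : κ → Matrix Y' Y ℂ) (ρ : Matrix (X × Y) (X × Y) ℂ) :
    Matrix (X × Y') (X × Y') ℂ :=
  krausMap (fun k => (1 : Matrix X X ℂ) ⊗ₖ L k) ρ

theorem sum_one_kronecker {L : κ → Matrix Y' Y ℂ} (hL : ∑ k, (L k)ᴴ * L k = 1) :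
    ∑ k, ((1 : Matrix X X ℂ) ⊗ₖ L k)ᴴ * ((1 : Matrix X X ℂ) ⊗ₖ L k) = 1 := by
  have : ∀ k, ((1 : Matrix X X ℂ) ⊗ₖ L k)ᴴ * ((1 : Matrix X X ℂ) ⊗ₖ L k)
      = (1 : Matrix X X ℂ) ⊗ₖ ((L k)ᴴ * L k) := fun k => by
    rw [conjTranspose_kronecker, ← mul_kronecker_mul, conjTranspose_one, Matrix.one_mul]
  simp only [this]
  rw [← one_kronecker_one, ← hL]
  ext p q
  simp [Matrix.sum_apply, Finset.mul_sum]

theorem IsState.localMap {L : κ → Matrix Y' Y ℂ} (hL : ∑ k, (L k)ᴴ * L k = 1)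
    {ρ : Matrix (X × Y) (X × Y) ℂ} (hρ : IsState ρ) : IsState (localMap L ρ) :=
  hρ.krausMap (sum_one_kronecker hL)

theorem localMap_apply (L : κ → Matrix Y' Y ℂ) (ρ : Matrix (X × Y) (X × Y) ℂ) (x x' : X)
    (y y' : Y') : localMap L ρ (x, y) (x', y')
      = ∑ k, (L k * ρ.submatrix (fun z => (x, z)) (fun z => (x', z)) * (L k)ᴴ) y y' := by
  simp only [localMap, krausMap, Matrix.sum_apply, Matrix.mul_apply, Fintype.sum_prod_type,
    kroneckerMap_apply, one_apply, conjTranspose_apply, submatrix_apply, ite_mul, one_mul,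
    zero_mul, apply_ite star, star_zero, mul_ite, mul_zero]
  refine Finset.sum_congr rfl fun k _ => ?_
  simp only [Finset.sum_comm (s := (Finset.univ : Finset X)), Finset.sum_ite_eq, Finset.mem_univ,
    if_true]

theorem traceFst_localMap (L : κ → Matrix Y' Y ℂ) (ρ : Matrix (X × Y) (X × Y) ℂ) :
    traceFst (localMap L ρ) = krausMap L (traceFst ρ) := by
  ext y y'
  simp only [traceFst, localMap_apply, krausMap, Matrix.sum_apply]
  rw [Finset.sum_comm]
  refine Finset.sum_congr rfl fun k _ => ?_
  have : traceFst ρ = ∑ x, ρ.submatrix (fun y => (x, y)) (fun y => (x, y)) := by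
    ext x x'
    simp [traceFst, Matrix.sum_apply]
  rw [← Matrix.sum_apply, ← Matrix.sum_mul, ← Matrix.mul_sum, ← this]

theorem traceSnd_localMap {L : κ → Matrix Y' Y ℂ} (hL : ∑ k, (L k)ᴴ * L k = 1)
    (ρ : Matrix (X × Y) (X × Y) ℂ) : traceSnd (localMap L ρ) = traceSnd ρ := by
  ext x x'
  have h := trace_krausMap hL (ρ.submatrix (fun z => (x, z)) (fun z => (x', z)))
  rw [krausMap, trace_sum] at h
  simp only [traceSnd, localMap_apply]
  rw [Finset.sum_comm]
  exact h

theorem localMap_kronecker (L : κ → Matrix Y' Y ℂ) (M : Matrix X X ℂ) (N : Matrix Y Y ℂ) :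
    localMap L (M ⊗ₖ N) = M ⊗ₖ krausMap L N := by
  rw [localMap, krausMap, krausMap]
  have : ∀ k, (1 : Matrix X X ℂ) ⊗ₖ L k * M ⊗ₖ N * ((1 : Matrix X X ℂ) ⊗ₖ L k)ᴴ
      = M ⊗ₖ (L k * N * (L k)ᴴ) := fun k => by
    rw [conjTranspose_kronecker, ← mul_kronecker_mul, ← mul_kronecker_mul, conjTranspose_one,
      Matrix.one_mul, Matrix.mul_one]
  simp only [this]
  ext p q
  simp [Matrix.sum_apply, Finset.mul_sum]

/-- A channel on the second system does not increase the mutual information. -/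
theorem mutualInfo_localMap_le {L : κ → Matrix Y' Y ℂ} (hL : ∑ k, (L k)ᴴ * L k = 1)
    {ρ : Matrix (X × Y) (X × Y) ℂ} (hρ : ρ.PosSemidef) :
    mutualInfo (localMap L ρ) ≤ mutualInfo ρ := by
  refine le_of_mul_le_mul_right ?_ (Real.log_pos one_lt_two)
  rw [mutualInfo_mul_log_two hρ, mutualInfo_mul_log_two (ρ := localMap L ρ) (krausMap_posSemidef _ hρ),
    traceSnd_localMap hL, traceFst_localMap, ← localMap_kronecker]
  exact relEntropy_krausMap_le (sum_one_kronecker hL) hρ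
    ((traceSnd_posSemidef hρ).kronecker (traceFst_posSemidef hρ)) (KerLE.marginals hρ)

end

/-! ### LOCC protocols as channels -/

section

variable {X Y Y' Y'' : Type*} [Fintype X] [DecidableEq X] [Fintype Y] [DecidableEq Y]
  [Fintype Y'] [DecidableEq Y'] [Fintype Y''] [DecidableEq Y'']

theorem sum_localMap_localMap {k m : ℕ} {κ : Fin k → Type} [∀ i, Fintype (κ i)]
    (L : ∀ i, κ i → Matrix Y'' Y' ℂ) (M : Fin k → Fin m → Matrix Y' Y ℂ)
    (ρ : Matrix (X × Y) (X × Y) ℂ) :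
    ∑ i, localMap (L i) (localMap (M i) ρ)
      = localMap (fun p : Σ i, κ i × Fin m => L p.1 p.2.1 * M p.1 p.2.2) ρ := by
  simp only [localMap, krausMap, Fintype.sum_sigma, Fintype.sum_prod_type]
  refine Finset.sum_congr rfl fun i _ => Finset.sum_congr rfl fun l _ => ?_
  rw [Matrix.mul_sum, Matrix.sum_mul]
  refine Finset.sum_congr rfl fun j _ => ?_
  have : (1 : Matrix X X ℂ) ⊗ₖ (L i l * M i j)
      = ((1 : Matrix X X ℂ) ⊗ₖ L i l) * ((1 : Matrix X X ℂ) ⊗ₖ M i j) := by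
    rw [← mul_kronecker_mul, Matrix.one_mul]
  rw [this, conjTranspose_mul]
  simp only [Matrix.mul_assoc]

theorem sum_conjTranspose_mul_sigma {k m : ℕ} {κ : Fin k → Type} [∀ i, Fintype (κ i)]
    {L : ∀ i, κ i → Matrix Y'' Y' ℂ} {M : Fin k → Fin m → Matrix Y' Y ℂ}
    (hL : ∀ i, ∑ l, (L i l)ᴴ * L i l = 1) (hM : ∑ i, ∑ j, (M i j)ᴴ * M i j = 1) :
    ∑ p : Σ i, κ i × Fin m, (L p.1 p.2.1 * M p.1 p.2.2)ᴴ * (L p.1 p.2.1 * M p.1 p.2.2) = 1 := by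
  simp only [Fintype.sum_sigma, Fintype.sum_prod_type]
  rw [← hM]
  refine Finset.sum_congr rfl fun i _ => ?_
  rw [Finset.sum_comm]
  refine Finset.sum_congr rfl fun j _ => ?_
  have : ∀ l, (L i l * M i j)ᴴ * (L i l * M i j) = (M i j)ᴴ * ((L i l)ᴴ * L i l) * M i j :=
    fun l => by rw [conjTranspose_mul]; simp only [Matrix.mul_assoc]
  simp only [this]
  rw [← Matrix.sum_mul, ← Matrix.mul_sum, hL, Matrix.mul_one]

end

theorem IsInstrument.sum_eq {X Y : Type*} [Fintype Y] [DecidableEq X] {k m : ℕ}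
    {K : Fin k → Fin m → Matrix Y X ℂ} (hK : IsInstrument K) :
    ∑ i, ∑ j, (K i j)ᴴ * K i j = 1 := by
  rw [IsInstrument] at hK
  convert hK

/-- An LOCC protocol acts as a channel on the joint system of Bob and Charlie. -/
theorem LOCC.exists_localMap {A : Type w} [Fintype A] [DecidableEq A] {B' : Type u} {C' : Type v}
    [Fintype B'] [DecidableEq B'] [Fintype C'] [DecidableEq C'] {B : Type u} {C : Type v}
    (P : LOCC B' C' B C) :
    ∀ [Fintype B] [DecidableEq B] [Fintype C] [DecidableEq C],
    ∃ (κ : Type) (_ : Fintype κ) (L : κ → Matrix (B' × C') (B × C) ℂ),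
      ∑ l, (L l)ᴴ * L l = 1 ∧
      ∀ σ : Matrix (A × B × C) (A × B × C) ℂ, P.apply σ = localMap L σ := by
  induction P with
  | done =>
    intro i1 i2 i3 i4
    refine ⟨Unit, inferInstance, fun _ => 1, ?_, fun σ => ?_⟩
    · simp
    · simp [LOCC.apply, localMap, krausMap]
  | @bob B C X _ _ k m K hK next ih =>
    intro i1 i2 i3 i4
    choose κ hκ L hL hσ using fun i => ih i
    refine ⟨Σ i, κ i × Fin m, inferInstance,
      fun p => L p.1 p.2.1 * (K p.1 p.2.2 ⊗ₖ (1 : Matrix C C ℂ)),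
      sum_conjTranspose_mul_sigma hL (M := fun i j => K i j ⊗ₖ (1 : Matrix C C ℂ)) ?_,
      fun σ => ?_⟩
    · have : ∀ i j, (K i j ⊗ₖ (1 : Matrix C C ℂ))ᴴ * (K i j ⊗ₖ (1 : Matrix C C ℂ))
          = ((K i j)ᴴ * K i j) ⊗ₖ (1 : Matrix C C ℂ) := fun i j => by
        rw [conjTranspose_kronecker, ← mul_kronecker_mul, conjTranspose_one, Matrix.one_mul]
      simp only [this]
      rw [← one_kronecker_one, ← hK.sum_eq]
      ext p q
      simp [Matrix.sum_apply, Finset.sum_mul]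
    · rw [← sum_localMap_localMap L (fun i j => K i j ⊗ₖ (1 : Matrix C C ℂ)), LOCC.apply]
      refine Finset.sum_congr rfl fun i _ => ?_
      rw [hσ]
      rfl
  | @charlie B C X _ _ k m K hK next ih =>
    intro i1 i2 i3 i4
    choose κ hκ L hL hσ using fun i => ih i
    refine ⟨Σ i, κ i × Fin m, inferInstance,
      fun p => L p.1 p.2.1 * ((1 : Matrix B B ℂ) ⊗ₖ K p.1 p.2.2),
      sum_conjTranspose_mul_sigma hL (M := fun i j => (1 : Matrix B B ℂ) ⊗ₖ K i j) ?_,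
      fun σ => ?_⟩
    · have : ∀ i j, ((1 : Matrix B B ℂ) ⊗ₖ K i j)ᴴ * ((1 : Matrix B B ℂ) ⊗ₖ K i j)
          = (1 : Matrix B B ℂ) ⊗ₖ ((K i j)ᴴ * K i j) := fun i j => by
        rw [conjTranspose_kronecker, ← mul_kronecker_mul, conjTranspose_one, Matrix.one_mul]
      simp only [this]
      rw [← one_kronecker_one, ← hK.sum_eq]
      ext p q
      simp [Matrix.sum_apply, Finset.mul_sum]
    · rw [← sum_localMap_localMap L (fun i j => (1 : Matrix B B ℂ) ⊗ₖ K i j), LOCC.apply]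
      refine Finset.sum_congr rfl fun i _ => ?_
      rw [hσ]
      rfl

section

variable {A : Type u} {B : Type v} {C : Type w} [Fintype A] [DecidableEq A] [Fintype B]
  [DecidableEq B] [Fintype C] [DecidableEq C]

/-- The Kraus operators are `⟨b| ⊗ 1` for the basis vectors `b` of Bob's system. -/
theorem exists_traceBob_eq_localMap :
    ∃ L : B → Matrix C (B × C) ℂ, ∑ l, (L l)ᴴ * L l = 1 ∧
      ∀ σ : Matrix (A × B × C) (A × B × C) ℂ, traceBob σ = localMap L σ := by
  refine ⟨fun b => Matrix.of fun c p => if p = (b, c) then 1 else 0, ?_, fun σ => ?_⟩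
  · ext p q
    simp only [Matrix.sum_apply, Matrix.mul_apply, conjTranspose_apply, one_apply, of_apply]
    rw [← Fintype.sum_prod_type' (f := fun b c => star (if p = (b, c) then (1 : ℂ) else 0) *
      if q = (b, c) then 1 else 0)]
    simp [eq_comm, apply_ite]
  · ext x x'
    rw [← Prod.mk.eta (p := x), ← Prod.mk.eta (p := x'), localMap_apply]
    refine Finset.sum_congr rfl fun b _ => ?_
    simp [Matrix.mul_apply, conjTranspose_apply, apply_ite]

/-- The Kraus operators are `1 ⊗ √τ |s⟩` for the basis vectors `s` of the register. -/
theorem exists_withRegister_eq_localMap {R : Type*} [Fintype R] [DecidableEq R] {τ : Matrix R R ℂ}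
    (hτ : IsState τ) :
    ∃ L : R → Matrix (B × C × R) (B × C) ℂ, ∑ l, (L l)ᴴ * L l = 1 ∧
      ∀ ρ : Matrix (A × B × C) (A × B × C) ℂ, withRegister ρ τ = localMap L ρ := by
  have hT := cfc_sqrt_mul_self hτ.1
  have hTH := (posSemidef_cfc hτ.1.1 Real.sqrt_nonneg).1
  have happ : ∀ r r', ∑ s, cfc Real.sqrt τ r s * star (cfc Real.sqrt τ r' s) = τ r r' := by
    intro r r'
    conv_rhs => rw [← hT, Matrix.mul_apply]
    exact Finset.sum_congr rfl fun s _ => by rw [← hTH.apply r' s, star_star]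
  generalize cfc Real.sqrt τ = T at happ
  refine ⟨fun s => Matrix.of fun p q => if (p.1, p.2.1) = q then T p.2.2 s else 0, ?_,
    fun ρ => ?_⟩
  · have htr : ∑ s, ∑ r, star (T r s) * T r s = 1 := by
      rw [Finset.sum_comm, ← hτ.2, trace]
      refine Finset.sum_congr rfl fun r _ => ?_
      rw [diag_apply, ← happ]
      exact Finset.sum_congr rfl fun s _ => mul_comm _ _
    ext q q'
    simp only [Matrix.sum_apply, Matrix.mul_apply, conjTranspose_apply, one_apply, of_apply,
      Fintype.sum_prod_type]
    by_cases h : q = q'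
    · subst h
      rw [if_pos rfl, ← htr]
      refine Finset.sum_congr rfl fun s _ => ?_
      rw [Finset.sum_eq_single q.1, Finset.sum_eq_single q.2]
      · simp
      · intro c _ hc
        simp [Prod.ext_iff, hc]
      · simp
      · intro b _ hb
        simp [Prod.ext_iff, hb]
      · simp
    · rw [if_neg h]
      refine Finset.sum_eq_zero fun s _ => Finset.sum_eq_zero fun b _ =>
        Finset.sum_eq_zero fun c _ => Finset.sum_eq_zero fun r _ => ?_
      by_cases h1 : (b, c) = q
      · rw [if_neg (fun h2 => h (h1.symm.trans h2)), mul_zero]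
      · rw [if_neg h1, star_zero, zero_mul]
  · ext x x'
    rw [← Prod.mk.eta (p := x), ← Prod.mk.eta (p := x'), localMap_apply]
    simp only [withRegister, ← happ, Finset.mul_sum]
    refine Finset.sum_congr rfl fun s _ => ?_
    simp [Matrix.mul_apply, conjTranspose_apply, apply_ite]
    ring

/-- Adding a register, running an LOCC protocol and tracing out Bob compose to a
channel that leaves Alice's system alone. -/
theorem mutualInfo_protocol_le {ρ : Matrix (A × B × C) (A × B × C) ℂ} (hρ : IsState ρ)
    {R : Type*} [Fintype R] [DecidableEq R] {τ : Matrix R R ℂ} (hτ : IsState τ)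
    (P : LOCC B (C × R) B (C × R)) :
    mutualInfo (traceBob (P.apply (withRegister ρ τ))) ≤ mutualInfo ρ := by
  obtain ⟨L₁, hL₁, h₁⟩ := exists_withRegister_eq_localMap (A := A) (B := B) (C := C) hτ
  obtain ⟨κ, _, L₂, hL₂, h₂⟩ := P.exists_localMap (A := A)
  obtain ⟨L₃, hL₃, h₃⟩ := exists_traceBob_eq_localMap (A := A) (B := B) (C := C × R)
  rw [h₃, h₂, h₁]
  have s₁ := hρ.localMap hL₁
  exact (mutualInfo_localMap_le hL₃ (s₁.localMap hL₂).1).trans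
    ((mutualInfo_localMap_le hL₂ s₁.1).trans (mutualInfo_localMap_le hL₁ hρ.1))

theorem IsState.protocol {ρ : Matrix (A × B × C) (A × B × C) ℂ} (hρ : IsState ρ)
    {R : Type*} [Fintype R] [DecidableEq R] {τ : Matrix R R ℂ} (hτ : IsState τ)
    (P : LOCC B (C × R) B (C × R)) :
    IsState (traceBob (P.apply (withRegister ρ τ))) := by
  obtain ⟨L₁, hL₁, h₁⟩ := exists_withRegister_eq_localMap (A := A) (B := B) (C := C) hτ
  obtain ⟨κ, _, L₂, hL₂, h₂⟩ := P.exists_localMap (A := A)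
  obtain ⟨L₃, hL₃, h₃⟩ := exists_traceBob_eq_localMap (A := A) (B := B) (C := C × R)
  rw [h₃, h₂, h₁]
  exact ((hρ.localMap hL₁).localMap hL₂).localMap hL₃

end

/-! ### Tensor powers -/

section

variable {Z : Type*} [Fintype Z] [DecidableEq Z]

/-- The `n`-fold tensor power of a matrix. -/
def tensorPower (M : Matrix Z Z ℂ) (n : ℕ) : Matrix (Fin n → Z) (Fin n → Z) ℂ :=
  fun x y => ∏ i, M (x i) (y i)

theorem tensorPower_mul (M N : Matrix Z Z ℂ) (n : ℕ) :
    tensorPower (M * N) n = tensorPower M n * tensorPower N n := by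
  ext x y
  simp only [tensorPower, Matrix.mul_apply, ← Finset.prod_mul_distrib]
  exact Fintype.prod_sum fun i z => M (x i) z * N z (y i)

theorem tensorPower_conjTranspose (M : Matrix Z Z ℂ) (n : ℕ) :
    (tensorPower M n)ᴴ = tensorPower Mᴴ n := by
  ext x y
  simp [tensorPower, conjTranspose_apply]

theorem tensorPower_diagonal (d : Z → ℂ) (n : ℕ) :
    tensorPower (diagonal d) n = diagonal fun x => ∏ i, d (x i) := by
  ext x y
  by_cases h : x = y
  · subst h
    simp [tensorPower]
  · obtain ⟨i, hi⟩ := Function.ne_iff.1 h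
    rw [diagonal_apply_ne _ h, tensorPower]
    exact Finset.prod_eq_zero (Finset.mem_univ i) (diagonal_apply_ne _ hi)

theorem tensorPower_one (n : ℕ) : tensorPower (1 : Matrix Z Z ℂ) n = 1 := by
  rw [← diagonal_one, tensorPower_diagonal]
  simp

theorem trace_tensorPower (M : Matrix Z Z ℂ) (n : ℕ) :
    (tensorPower M n).trace = M.trace ^ n := by
  simp only [trace, diag_apply, tensorPower]
  rw [Fintype.sum_pow]

theorem IsEigendecomposition.tensorPower {ρ U : Matrix Z Z ℂ} {a : Z → ℝ}
    (h : IsEigendecomposition ρ U a) (n : ℕ) :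
    IsEigendecomposition (tensorPower ρ n) (tensorPower U n) (fun x => ∏ i, a (x i)) where
  conjTranspose_mul := by
    rw [tensorPower_conjTranspose, ← tensorPower_mul, h.conjTranspose_mul, tensorPower_one]
  mul_conjTranspose := by
    rw [tensorPower_conjTranspose, ← tensorPower_mul, h.mul_conjTranspose, tensorPower_one]
  eq_conj := by
    conv_lhs => rw [h.eq_conj]
    rw [tensorPower_mul, tensorPower_mul, tensorPower_diagonal, tensorPower_conjTranspose]
    push_cast
    rfl

theorem IsState.tensorPower {ρ : Matrix Z Z ℂ} (hρ : IsState ρ) (n : ℕ) :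
    IsState (tensorPower ρ n) := by
  have h := IsEigendecomposition.of_isHermitian hρ.1.1
  refine ⟨(h.tensorPower n).posSemidef fun x => Finset.prod_nonneg fun i _ => h.nonneg hρ.1 _, ?_⟩
  rw [trace_tensorPower, hρ.2, one_pow]

/-- Additivity of the Shannon entropy for independent copies. -/
theorem sum_negMulLog_prod {a : Z → ℝ} (ha : ∑ z, a z = 1) (n : ℕ) :
    ∑ x : Fin n → Z, Real.negMulLog (∏ i, a (x i)) = n * ∑ z, Real.negMulLog (a z) := by
  have h1 : ∀ x : Fin n → Z, Real.negMulLog (∏ i, a (x i))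
      = ∑ k, ∏ i, if i = k then Real.negMulLog (a (x i)) else a (x i) := by
    intro x
    have h2 : ∀ k, (∏ i, if i = k then Real.negMulLog (a (x i)) else a (x i))
        = -Real.log (a (x k)) * ∏ i, a (x i) := by
      intro k
      rw [← Finset.mul_prod_erase _ _ (Finset.mem_univ k),
        ← Finset.mul_prod_erase Finset.univ (fun i => a (x i)) (Finset.mem_univ k), if_pos rfl,
        Real.negMulLog]
      have : ∏ i ∈ Finset.univ.erase k, (if i = k then Real.negMulLog (a (x i)) else a (x i))
          = ∏ i ∈ Finset.univ.erase k, a (x i) :=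
        Finset.prod_congr rfl fun i hi => if_neg (Finset.ne_of_mem_erase hi)
      rw [this]
      ring
    simp only [h2]
    rw [← Finset.sum_mul, Finset.sum_neg_distrib]
    by_cases h0 : ∏ i, a (x i) = 0
    · simp [h0]
    · rw [Real.negMulLog, Real.log_prod fun i hi => Finset.prod_ne_zero_iff.1 h0 i hi]
      ring
  simp only [h1]
  rw [Finset.sum_comm]
  have h3 : ∀ k : Fin n, ∑ x : Fin n → Z, ∏ i, (if i = k then Real.negMulLog (a (x i)) else a (x i))
      = ∑ z, Real.negMulLog (a z) := by
    intro k
    rw [← Fintype.prod_sum fun i z => if i = k then Real.negMulLog (a z) else a z,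
      ← Finset.mul_prod_erase _ _ (Finset.mem_univ k)]
    have : ∏ i ∈ Finset.univ.erase k, ∑ z, (if i = k then Real.negMulLog (a z) else a z) = 1 :=
      Finset.prod_eq_one fun i hi => by
        simp only [if_neg (Finset.ne_of_mem_erase hi)]
        exact ha
    rw [this]
    simp
  simp [h3]

theorem entropy_tensorPower {ρ : Matrix Z Z ℂ} (hρ : IsState ρ) (n : ℕ) :
    entropy (tensorPower ρ n) = n * entropy ρ := by
  have h := IsEigendecomposition.of_isHermitian hρ.1.1
  have htr := hρ.2
  rw [h.trace_eq] at htr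
  rw [(h.tensorPower n).entropy_eq, h.entropy_eq,
    sum_negMulLog_prod (by exact_mod_cast htr), mul_div_assoc]

end

section

variable {A : Type u} {B : Type v} {C : Type w} [Fintype A] [DecidableEq A] [Fintype B]
  [DecidableEq B] [Fintype C] [DecidableEq C]

/-- A pair of strings of length `n`, read as a string of pairs. -/
def arrowProd (Y : Type*) (Z : Type*) (n : ℕ) : (Fin n → Y) × (Fin n → Z) ≃ (Fin n → Y × Z) :=
  (Equiv.arrowProdEquivProdArrow (Fin n) (fun _ => Y) (fun _ => Z)).symm

theorem copies_eq (ρ : Matrix (A × B × C) (A × B × C) ℂ) (n : ℕ) :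
    copies ρ n = (tensorPower ρ n).submatrix
      (((Equiv.refl _).prodCongr (arrowProd B C n)).trans (arrowProd A (B × C) n))
      (((Equiv.refl _).prodCongr (arrowProd B C n)).trans (arrowProd A (B × C) n)) := rfl

theorem IsState.submatrix_equiv {m n : Type*} [Fintype m] [Fintype n] {ρ : Matrix n n ℂ}
    (hρ : IsState ρ) (e : m ≃ n) : IsState (ρ.submatrix e e) :=
  ⟨hρ.1.submatrix e, by rw [← hρ.2]; exact Equiv.sum_comp e fun i => ρ i i⟩

theorem IsState.copies {ρ : Matrix (A × B × C) (A × B × C) ℂ} (hρ : IsState ρ) (n : ℕ) :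
    IsState (copies ρ n) := by
  rw [copies_eq]
  exact (hρ.tensorPower n).submatrix_equiv _

theorem traceSnd_copies (ρ : Matrix (A × B × C) (A × B × C) ℂ) (n : ℕ) :
    traceSnd (copies ρ n) = tensorPower (traceSnd ρ) n := by
  ext x x'
  simp only [traceSnd, tensorPower]
  rw [Fintype.prod_sum fun i y => ρ (x i, y) (x' i, y)]
  exact Fintype.sum_equiv (arrowProd B C n) _ _ fun y => rfl

theorem traceFst_copies (ρ : Matrix (A × B × C) (A × B × C) ℂ) (n : ℕ) :
    traceFst (copies ρ n)
      = (tensorPower (traceFst ρ) n).submatrix (arrowProd B C n) (arrowProd B C n) := by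
  ext y y'
  simp only [traceFst, tensorPower, submatrix_apply]
  rw [Fintype.prod_sum fun i x => ρ (x, arrowProd B C n y i) (x, arrowProd B C n y' i)]
  rfl

theorem mutualInfo_copies {ρ : Matrix (A × B × C) (A × B × C) ℂ} (hρ : IsState ρ) (n : ℕ) :
    mutualInfo (copies ρ n) = n * mutualInfo ρ := by
  rw [mutualInfo, traceSnd_copies, traceFst_copies, copies_eq,
    entropy_submatrix_equiv (hρ.tensorPower n).1.1,
    entropy_submatrix_equiv (hρ.traceFst.tensorPower n).1.1, entropy_tensorPower hρ.traceSnd,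
    entropy_tensorPower hρ.traceFst, entropy_tensorPower hρ, mutualInfo]
  ring

theorem target_eq (ρ : Matrix (A × B × C) (A × B × C) ℂ) :
    target ρ = ρ.submatrix ((Equiv.refl A).prodCongr (Equiv.prodComm C B))
      ((Equiv.refl A).prodCongr (Equiv.prodComm C B)) := rfl

theorem mutualInfo_submatrix_equiv {X X' Y Y' : Type*} [Fintype X] [DecidableEq X] [Fintype Y]
    [DecidableEq Y] [Fintype X'] [DecidableEq X'] [Fintype Y'] [DecidableEq Y']
    {ρ : Matrix (X × Y) (X × Y) ℂ} (hρ : ρ.PosSemidef) (e : X' ≃ X) (f : Y' ≃ Y) :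
    mutualInfo (ρ.submatrix (e.prodCongr f) (e.prodCongr f)) = mutualInfo ρ := by
  have h1 : traceSnd (ρ.submatrix (e.prodCongr f) (e.prodCongr f))
      = (traceSnd ρ).submatrix e e := by
    ext x x'
    exact Equiv.sum_comp f fun y => ρ (e x, y) (e x', y)
  have h2 : traceFst (ρ.submatrix (e.prodCongr f) (e.prodCongr f))
      = (traceFst ρ).submatrix f f := by
    ext y y'
    exact Equiv.sum_comp e fun x => ρ (x, f y) (x, f y')
  rw [mutualInfo, h1, h2, entropy_submatrix_equiv hρ.1,
    entropy_submatrix_equiv (traceSnd_posSemidef hρ).1,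
    entropy_submatrix_equiv (traceFst_posSemidef hρ).1, mutualInfo]

end

/-! ### Fidelity and continuity -/

section

variable {n : Type*} [Fintype n] [DecidableEq n]

/-- The partial isometry `W` of the polar decomposition `M = W √(Mᴴ M)`. -/
theorem exists_polar (M : Matrix n n ℂ) :
    ∃ W : Matrix n n ℂ, Wᴴ * M = cfc Real.sqrt (Mᴴ * M) ∧ (1 - W * Wᴴ).PosSemidef := by
  have hN := posSemidef_conjTranspose_mul_self M
  have h := IsEigendecomposition.of_isHermitian hN.1
  have ha := h.nonneg hN
  generalize (hN.1.eigenvectorUnitary : Matrix n n ℂ) = U at h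
  generalize hN.1.eigenvalues = a at h ha
  -- The inverse on the support; `0⁻¹ = 0` takes care of the kernel.
  set G : Matrix n n ℂ := cfc (fun x : ℝ => (Real.sqrt x)⁻¹) (Mᴴ * M) with hG
  have hGH : Gᴴ = G := (posSemidef_cfc hN.1 fun x => inv_nonneg.2 (Real.sqrt_nonneg x)).1
  have hGN : G * (Mᴴ * M) = cfc Real.sqrt (Mᴴ * M) := by
    have e : G * (Mᴴ * M) = U * diagonal (fun i => (((Real.sqrt (a i))⁻¹ : ℝ) : ℂ)) * Uᴴ *
        (U * diagonal (fun i => (a i : ℂ)) * Uᴴ) := by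
      rw [← h.eq_conj, hG, h.cfc_eq]
    rw [e, h.conj_mul_conj, h.cfc_eq]
    congr 3
    ext i
    rw [← Complex.ofReal_mul]
    congr 1
    rcases (ha i).eq_or_lt with h0 | h0
    · simp [← h0]
    · rw [inv_mul_eq_div, Real.div_sqrt]
  have hWH : (M * G)ᴴ * M = cfc Real.sqrt (Mᴴ * M) := by
    rw [conjTranspose_mul, hGH, Matrix.mul_assoc, hGN]
  have hidem : (M * G) * ((M * G)ᴴ * (M * G)) = M * G := by
    rw [← Matrix.mul_assoc (M * G)ᴴ, hWH, Matrix.mul_assoc]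
    congr 1
    rw [hG, h.cfc_eq, h.cfc_eq, h.conj_mul_conj, h.conj_mul_conj]
    congr 3
    ext i
    rw [← Complex.ofReal_mul, ← Complex.ofReal_mul]
    congr 1
    by_cases h0 : Real.sqrt (a i) = 0
    · simp [h0]
    · rw [mul_inv_cancel₀ h0, mul_one]
  refine ⟨M * G, hWH, ?_⟩
  generalize M * G = W at hidem
  have e : 1 - W * Wᴴ = (1 - W * Wᴴ)ᴴ * (1 - W * Wᴴ) := by
    have e1 : W * Wᴴ * (W * Wᴴ) = W * Wᴴ := by
      rw [Matrix.mul_assoc, ← Matrix.mul_assoc Wᴴ, ← Matrix.mul_assoc W, hidem]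
    rw [conjTranspose_sub, conjTranspose_mul, conjTranspose_conjTranspose, conjTranspose_one,
      Matrix.mul_sub, Matrix.sub_mul, Matrix.sub_mul, e1, Matrix.mul_one, Matrix.one_mul]
    simp
  rw [e]
  exact posSemidef_conjTranspose_mul_self _

/-- States of fidelity close to `1` dominate each other up to a small positive perturbation.
Writing `ρ = X Xᴴ` and, by the polar decomposition of `√σ √ρ`, `Y Yᴴ ≤ σ` with
`Tr (Yᴴ X)` equal to the fidelity, the perturbation comes from
`X Xᴴ ≤ (1 + s) Y Yᴴ + (1 + s⁻¹) (X - Y) (X - Y)ᴴ`. -/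
theorem exists_add_eq_add_of_fidelity {ρ σ : Matrix n n ℂ} (hρ : IsState ρ) (hσ : IsState σ)
    {s : ℝ} (hs : 0 < s) (hs1 : s ≤ 1) (hF : 1 - s ^ 2 / 2 ≤ fidelity ρ σ) :
    ∃ B C : Matrix n n ℂ, B.PosSemidef ∧ C.PosSemidef ∧ ρ + B = σ + C ∧ C.trace.re ≤ 3 * s := by
  set X := cfc Real.sqrt ρ with hX
  set T := cfc Real.sqrt σ with hT
  have hXH : Xᴴ = X := (posSemidef_cfc hρ.1.1 Real.sqrt_nonneg).1
  have hTH : Tᴴ = T := (posSemidef_cfc hσ.1.1 Real.sqrt_nonneg).1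
  have hXX : X * X = ρ := cfc_sqrt_mul_self hρ.1
  have hTT : T * T = σ := cfc_sqrt_mul_self hσ.1
  obtain ⟨W, hW, hWW⟩ := exists_polar (T * X)
  have hM : (T * X)ᴴ * (T * X) = X * σ * X := by
    rw [conjTranspose_mul, hXH, hTH, ← hTT]
    simp only [Matrix.mul_assoc]
  set Y := T * W with hY
  have hYX : (Yᴴ * X).trace.re = fidelity ρ σ := by
    rw [fidelity, ← hX, ← hM, ← hW, hY, conjTranspose_mul, hTH, Matrix.mul_assoc]
  have hE : (σ - Y * Yᴴ).PosSemidef := by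
    have : σ - Y * Yᴴ = T * (1 - W * Wᴴ) * Tᴴ := by
      rw [hY, conjTranspose_mul, hTH, ← hTT, Matrix.mul_sub, Matrix.sub_mul, Matrix.mul_one]
      simp only [Matrix.mul_assoc]
    rw [this]
    exact hWW.mul_mul_conjTranspose_same T
  have hYtr : (Y * Yᴴ).trace.re ≤ 1 := by
    have := (Complex.le_def.1 hE.trace_nonneg).1
    rw [trace_sub, hσ.2, Complex.sub_re, Complex.one_re, Complex.zero_re] at this
    linarith
  have hZtr : ((X - Y) * (X - Y)ᴴ).trace.re ≤ s ^ 2 := by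
    have e1 : (X * Yᴴ).trace.re = fidelity ρ σ := by rw [trace_mul_comm, hYX]
    have e2 : (Y * X).trace.re = fidelity ρ σ := by
      have : (Y * X).trace = star (X * Yᴴ).trace := by
        rw [← trace_conjTranspose, conjTranspose_mul, conjTranspose_conjTranspose, hXH]
      rw [this, Complex.star_def, Complex.conj_re, e1]
    rw [conjTranspose_sub, Matrix.mul_sub, Matrix.sub_mul, Matrix.sub_mul, trace_sub, trace_sub,
      trace_sub, hXH, hXX, hρ.2, Complex.sub_re, Complex.sub_re, Complex.sub_re, e1, e2,
      Complex.one_re]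
    linarith
  set C : Matrix n n ℂ := (s : ℂ) • (Y * Yᴴ) + ((1 + s⁻¹ : ℝ) : ℂ) • ((X - Y) * (X - Y)ᴴ) with hC
  have hs0 : (0 : ℂ) ≤ (s : ℂ) := by exact_mod_cast hs.le
  have hs2 : (0 : ℂ) ≤ ((1 + s⁻¹ : ℝ) : ℂ) := by
    have : 0 ≤ 1 + s⁻¹ := by positivity
    exact_mod_cast this
  have hCpos : C.PosSemidef := ((posSemidef_self_mul_conjTranspose Y).smul hs0).add
    ((posSemidef_self_mul_conjTranspose (X - Y)).smul hs2)
  refine ⟨σ + C - ρ, C, ?_, hCpos, by abel, ?_⟩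
  · have hsq : ((Real.sqrt s : ℝ) : ℂ) * ((Real.sqrt s : ℝ) : ℂ) = s := by
      rw [← Complex.ofReal_mul, Real.mul_self_sqrt hs.le]
    have hsne : ((Real.sqrt s : ℝ) : ℂ) ≠ 0 := by
      exact_mod_cast (Real.sqrt_pos.2 hs).ne'
    have e : σ + C - ρ = (σ - Y * Yᴴ) +
        (((Real.sqrt s : ℝ) : ℂ) • Y - ((Real.sqrt s : ℝ) : ℂ)⁻¹ • (X - Y)) *
        (((Real.sqrt s : ℝ) : ℂ) • Y - ((Real.sqrt s : ℝ) : ℂ)⁻¹ • (X - Y))ᴴ := by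
      have hρ' : ρ = (Y + (X - Y)) * (Y + (X - Y))ᴴ := by
        rw [add_sub_cancel, hXH, hXX]
      rw [hC, hρ']
      generalize X - Y = Z
      have hstar : star ((Real.sqrt s : ℝ) : ℂ) = ((Real.sqrt s : ℝ) : ℂ) := Complex.conj_ofReal _
      rw [conjTranspose_sub, conjTranspose_smul, conjTranspose_smul, star_inv₀, hstar,
        conjTranspose_add]
      simp only [Matrix.mul_sub, Matrix.sub_mul, Matrix.mul_add, Matrix.add_mul, Matrix.smul_mul,
        Matrix.mul_smul, smul_sub, smul_smul, hsq, inv_mul_cancel₀ hsne, mul_inv_cancel₀ hsne, one_smul,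
        ← mul_inv]
      rw [Complex.ofReal_add, Complex.ofReal_one, Complex.ofReal_inv, add_smul, one_smul]
      abel
    rw [e]
    exact hE.add (posSemidef_self_mul_conjTranspose _)
  · rw [hC, trace_add, trace_smul, trace_smul, Complex.add_re, smul_eq_mul, smul_eq_mul,
      Complex.re_ofReal_mul, Complex.re_ofReal_mul]
    have h1 : s * (Y * Yᴴ).trace.re ≤ s := by nlinarith
    have h2 : (1 + s⁻¹) * ((X - Y) * (X - Y)ᴴ).trace.re ≤ (1 + s⁻¹) * s ^ 2 :=
      mul_le_mul_of_nonneg_left hZtr (by positivity)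
    have h3 : (1 + s⁻¹) * s ^ 2 = s ^ 2 + s := by field_simp
    nlinarith

end

section

variable {X Y : Type*} [Fintype X] [DecidableEq X] [Fintype Y] [DecidableEq Y]

theorem IsState.card_pos {ρ : Matrix X X ℂ} (hρ : IsState ρ) : 0 < Fintype.card X := by
  rw [Fintype.card_pos_iff]
  by_contra h
  rw [not_nonempty_iff] at h
  have := hρ.2
  simp [trace] at this

/-- A form of the asymptotic continuity of the mutual information. -/
theorem mutualInfo_le_of_fidelity {ρ σ : Matrix (X × Y) (X × Y) ℂ} (hρ : IsState ρ)
    (hσ : IsState σ) {s : ℝ} (hs : 0 < s) (hs1 : 3 * s ≤ 1)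
    (hF : 1 - s ^ 2 / 2 ≤ fidelity ρ σ) :
    mutualInfo σ * Real.log 2 ≤ mutualInfo ρ * Real.log 2
      + 6 * s * (Real.log (Fintype.card X) + Real.log (Fintype.card Y)) + 12 := by
  obtain ⟨B, C, hB, hC, h, htr⟩ := exists_add_eq_add_of_fidelity hρ hσ hs (by linarith) hF
  have htr' : B.trace.re = C.trace.re := by
    have := congrArg (fun M => (Matrix.trace M).re) h
    simp only [trace_add, hρ.2, hσ.2, Complex.add_re] at this
    linarith
  have hS : traceSnd σ + traceSnd C = traceSnd ρ + traceSnd B := by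
    ext x x'
    have := congrArg (fun M => traceSnd M x x') h
    simpa [traceSnd, Finset.sum_add_distrib] using this.symm
  have hFst : traceFst σ + traceFst C = traceFst ρ + traceFst B := by
    ext x x'
    have := congrArg (fun M => traceFst M x x') h
    simpa [traceFst, Finset.sum_add_distrib] using this.symm
  have k1 := entropy_mul_log_two_le_add hρ hσ hB hC h (by linarith)
  have k2 := entropy_mul_log_two_le_add hσ.traceSnd hρ.traceSnd (traceSnd_posSemidef hC)
    (traceSnd_posSemidef hB) hS (by rw [trace_traceSnd]; linarith)
  have k3 := entropy_mul_log_two_le_add hσ.traceFst hρ.traceFst (traceFst_posSemidef hC)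
    (traceFst_posSemidef hB) hFst (by rw [trace_traceFst]; linarith)
  have cX : 1 ≤ Fintype.card X := hρ.traceSnd.card_pos
  have cY : 1 ≤ Fintype.card Y := hρ.traceFst.card_pos
  have lX : 0 ≤ Real.log (Fintype.card X) := Real.log_nonneg (by exact_mod_cast cX)
  have lY : 0 ≤ Real.log (Fintype.card Y) := Real.log_nonneg (by exact_mod_cast cY)
  rw [trace_traceSnd, htr'] at k2
  rw [trace_traceFst, htr'] at k3
  rw [Fintype.card_prod, Nat.cast_mul, Real.log_mul (by positivity) (by positivity)] at k1
  have b1 := mul_le_mul_of_nonneg_right htr lX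
  have b2 := mul_le_mul_of_nonneg_right htr lY
  rw [mutualInfo, mutualInfo]
  nlinarith

end

/-! ### Relabelling of Charlie's systems -/

theorem submatrix_conj {n m n' m' : Type*} [Fintype n] [Fintype n']
    (L' : Matrix m' n' ℂ) (σ : Matrix n' n' ℂ) (g : m ≃ m') (h : n ≃ n') :
    (L' * σ * L'ᴴ).submatrix g g
      = L'.submatrix g h * σ.submatrix h h * (L'.submatrix g h)ᴴ := by
  rw [conjTranspose_submatrix, submatrix_mul_equiv, submatrix_mul_equiv]

theorem submatrix_sum {n m ι : Type*} [Fintype ι] (M : ι → Matrix n n ℂ) (g : m → n) :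
    (∑ i, M i).submatrix g g = ∑ i, (M i).submatrix g g := by
  ext p q
  simp [Matrix.sum_apply]

/-- The relabelling of Charlie's system, extended to all three parties. -/
abbrev relabel (A : Type*) (B : Type*) {C D : Type*} (e : C ≃ D) : A × B × C ≃ A × B × D :=
  (Equiv.refl A).prodCongr ((Equiv.refl B).prodCongr e)

/-- A protocol can be carried over to relabelled systems of Charlie, possibly in another universe.
Charlie's intermediate systems are replaced by copies of `Fin k`, and a last round
of Charlie restores the labels. -/
theorem LOCC.exists_relabel {A : Type w} [Fintype A] [DecidableEq A] {B' : Type u} {C' : Type v}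
    {D' : Type x} [Fintype D'] [DecidableEq D'] (e' : C' ≃ D') {B : Type u} {C : Type v}
    (P : LOCC B' C' B C) :
    ∀ [Fintype B] [DecidableEq B] [Fintype C] [DecidableEq C] {D : Type x} [Fintype D]
      [DecidableEq D] (e : C ≃ D), ∃ Q : LOCC B' D' B D,
      ∀ σ : Matrix (A × B × D) (A × B × D) ℂ,
        (Q.apply σ).submatrix (relabel A B' e') (relabel A B' e')
          = P.apply (σ.submatrix (relabel A B e) (relabel A B e)) := by
  induction P with
  | done =>
    intro i1 i2 i3 i4 D _ _ e
    set g : D ≃ D' := e.symm.trans e'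
    have hK : IsInstrument (fun _ _ : Fin 1 => (1 : Matrix D' D' ℂ).submatrix id g) := by
      rw [IsInstrument]
      simp only [Finset.univ_unique, Finset.sum_const, Finset.card_singleton, one_smul]
      rw [conjTranspose_submatrix, conjTranspose_one,
        ← submatrix_mul _ _ g id g Function.bijective_id, Matrix.one_mul, submatrix_one_equiv]
      congr!
    refine ⟨.charlie _ hK fun _ => .done, fun σ => ?_⟩
    simp only [LOCC.apply, Finset.univ_unique, Finset.sum_const, Finset.card_singleton, one_smul]
    rw [submatrix_conj _ _ _ (relabel A B' e)]
    have : ((1 : Matrix A A ℂ) ⊗ₖ ((1 : Matrix B' B' ℂ) ⊗ₖ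
        (1 : Matrix D' D' ℂ).submatrix id g)).submatrix (relabel A B' e') (relabel A B' e) = 1 := by
      ext ⟨a, b, c⟩ ⟨a', b', c'⟩
      simp [one_apply, g, ← ite_and, and_comm]
    rw [this]
    simp
  | @bob B C X _ _ k m K hK next ih =>
    intro i1 i2 i3 i4 D _ _ e
    choose Q hQ using fun i => ih i e
    refine ⟨.bob K hK Q, fun σ => ?_⟩
    simp only [LOCC.apply]
    rw [submatrix_sum]
    refine Finset.sum_congr rfl fun i _ => ?_
    rw [hQ, submatrix_sum]
    congr 1
    refine Finset.sum_congr rfl fun j _ => ?_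
    rw [submatrix_conj _ _ _ (relabel A B e)]
    have : ((1 : Matrix A A ℂ) ⊗ₖ (K i j ⊗ₖ (1 : Matrix D D ℂ))).submatrix (relabel A X e)
        (relabel A B e) = (1 : Matrix A A ℂ) ⊗ₖ (K i j ⊗ₖ (1 : Matrix C C ℂ)) := by
      ext ⟨a, b, c⟩ ⟨a', b', c'⟩
      simp [one_apply]
    rw [this]
  | @charlie B C X _ _ k m K hK next ih =>
    intro i1 i2 i3 i4 D _ _ e
    set eX : X ≃ ULift.{x} (Fin (Fintype.card X)) := (Fintype.equivFin X).trans Equiv.ulift.symm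
    choose Q hQ using fun i => ih i eX
    have hK' : IsInstrument (fun i j => (K i j).submatrix eX.symm e.symm) := by
      rw [IsInstrument]
      simp only [conjTranspose_submatrix, submatrix_mul_equiv]
      have h := congrArg (fun M => M.submatrix e.symm e.symm) hK.sum_eq
      simp only [submatrix_sum, submatrix_one_equiv] at h
      rw [h]
      congr!
    refine ⟨.charlie _ hK' Q, fun σ => ?_⟩
    simp only [LOCC.apply]
    rw [submatrix_sum]
    refine Finset.sum_congr rfl fun i _ => ?_
    rw [hQ, submatrix_sum]
    congr 1
    refine Finset.sum_congr rfl fun j _ => ?_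
    rw [submatrix_conj _ _ _ (relabel A B e)]
    have : ((1 : Matrix A A ℂ) ⊗ₖ ((1 : Matrix B B ℂ) ⊗ₖ
        (K i j).submatrix eX.symm e.symm)).submatrix (relabel A B eX) (relabel A B e)
        = (1 : Matrix A A ℂ) ⊗ₖ ((1 : Matrix B B ℂ) ⊗ₖ K i j) := by
      ext ⟨a, b, c⟩ ⟨a', b', c'⟩
      simp [one_apply]
    rw [this]

/-! ### Bounds on the concentrated information -/

section

variable {A : Type u} {B : Type v} {C : Type w} [Fintype A] [DecidableEq A] [Fintype B]
  [DecidableEq B] [Fintype C] [DecidableEq C]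

theorem mutualInfo_mem_upperBounds {ρ : Matrix (A × B × C) (A × B × C) ℂ} (hρ : IsState ρ) :
    mutualInfo ρ ∈ upperBounds {x : ℝ | ∃ (r : ℕ) (τ : Matrix (Fin r) (Fin r) ℂ)
      (P : LOCC B (C × Fin r) B (C × Fin r)),
        IsState τ ∧ x = mutualInfo (traceBob (P.apply (withRegister ρ τ)))} := by
  rintro x ⟨r, τ, P, hτ, rfl⟩
  exact mutualInfo_protocol_le hρ hτ P

theorem concentratedInfo_le {ρ : Matrix (A × B × C) (A × B × C) ℂ} (hρ : IsState ρ) :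
    concentratedInfo ρ ≤ mutualInfo ρ := by
  refine csSup_le ?_ (mutualInfo_mem_upperBounds hρ)
  exact ⟨_, 1, 1, .done, ⟨PosSemidef.one, by simp⟩, rfl⟩

/-- Every finite register, of whatever index type, is admissible for the concentrated
information. -/
theorem le_concentratedInfo {ρ : Matrix (A × B × C) (A × B × C) ℂ} (hρ : IsState ρ)
    {R : Type*} [Fintype R] [DecidableEq R] {τ : Matrix R R ℂ} (hτ : IsState τ)
    (P : LOCC B (C × R) B (C × R)) :
    mutualInfo (traceBob (P.apply (withRegister ρ τ))) ≤ concentratedInfo ρ := by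
  set eR : R ≃ Fin (Fintype.card R) := Fintype.equivFin R
  set e : C × R ≃ C × Fin (Fintype.card R) := (Equiv.refl C).prodCongr eR
  obtain ⟨Q, hQ⟩ := P.exists_relabel (A := A) e e
  have hτ' : IsState (τ.submatrix eR.symm eR.symm) := hτ.submatrix_equiv eR.symm
  have h1 : (withRegister ρ (τ.submatrix eR.symm eR.symm)).submatrix (relabel A B e)
      (relabel A B e) = withRegister ρ τ := by
    ext p q
    simp [withRegister, e]
  have h2 := hQ (withRegister ρ (τ.submatrix eR.symm eR.symm))
  rw [h1] at h2
  have h3 : traceBob (P.apply (withRegister ρ τ))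
      = (traceBob (Q.apply (withRegister ρ (τ.submatrix eR.symm eR.symm)))).submatrix
        ((Equiv.refl A).prodCongr e) ((Equiv.refl A).prodCongr e) := by
    rw [← h2]
    rfl
  rw [h3, mutualInfo_submatrix_equiv (hρ.protocol hτ' Q).1]
  exact le_csSup ⟨_, mutualInfo_mem_upperBounds hρ⟩ ⟨_, _, Q, hτ', rfl⟩

/-- Merging with fidelity close to `1` concentrates almost all of the mutual information. -/
theorem mutualInfo_le_concentratedInfo {ρ : Matrix (A × B × C) (A × B × C) ℂ} (hρ : IsState ρ)
    {s : ℝ} (hs : 0 < s) (hs1 : 3 * s ≤ 1) (hF : 1 - s ^ 2 / 2 < mergingFidelity ρ) :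
    mutualInfo ρ * Real.log 2 ≤ concentratedInfo ρ * Real.log 2
      + 6 * s * (Real.log (Fintype.card A) + Real.log (Fintype.card (C × B))) + 12 := by
  obtain ⟨x, ⟨τ, P, hτ, rfl⟩, hx⟩ := exists_lt_of_lt_csSup (by
    by_contra h
    rw [Set.not_nonempty_iff_eq_empty] at h
    rw [mergingFidelity, h, Real.sSup_empty] at hF
    nlinarith) hF
  have ht : IsState (target ρ) := by
    rw [target_eq]
    exact hρ.submatrix_equiv _
  have h1 := mutualInfo_le_of_fidelity (hρ.protocol hτ P) ht hs hs1 hx.le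
  have h2 : mutualInfo (target ρ) = mutualInfo ρ := by
    rw [target_eq, mutualInfo_submatrix_equiv hρ.1]
  rw [h2] at h1
  have h3 := mul_le_mul_of_nonneg_right (le_concentratedInfo hρ hτ P)
    (Real.log_nonneg one_le_two)
  linarith

end

end QInfo

theorem mainTheorem7 {A : Type u} {B : Type v} {C : Type w}
    [Fintype A] [DecidableEq A] [Fintype B] [DecidableEq B] [Fintype C] [DecidableEq C]
    (ρ : Matrix (A × B × C) (A × B × C) ℂ) (hρ : QInfo.IsState ρ)
    (hF : Tendsto (fun n : ℕ => QInfo.mergingFidelity (QInfo.copies ρ n)) atTop (𝓝 1)) :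
    Tendsto (fun n : ℕ => QInfo.concentratedInfo (QInfo.copies ρ n) / (n : ℝ)) atTop
      (𝓝 (QInfo.mutualInfo ρ)) := by
  have hl2 : 0 < Real.log 2 := Real.log_pos one_lt_two
  set c := Real.log (Fintype.card A) + Real.log (Fintype.card (C × B)) with hc
  have hc0 : 0 ≤ c := add_nonneg (Real.log_natCast_nonneg _) (Real.log_natCast_nonneg _)
  rw [Metric.tendsto_atTop']
  intro δ hδ
  -- With this `s` the continuity error per copy is at most `δ / 2`.
  set s := min (1 / 3) (δ * Real.log 2 / (12 * (c + 1))) with hs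
  have hs0 : 0 < s := lt_min (by norm_num) (by positivity)
  have hs1 : 3 * s ≤ 1 := by
    have := min_le_left (1 / 3) (δ * Real.log 2 / (12 * (c + 1)))
    linarith
  have hs2 : 6 * s * c ≤ δ * Real.log 2 / 2 := by
    have h1 := min_le_right (1 / 3) (δ * Real.log 2 / (12 * (c + 1)))
    rw [← hs, le_div_iff₀ (by positivity)] at h1
    nlinarith
  have hev := hF.eventually (lt_mem_nhds (show 1 - s ^ 2 / 2 < 1 by nlinarith))
  obtain ⟨N, hN⟩ := eventually_atTop.1 hev
  obtain ⟨M, hM⟩ := exists_nat_gt (24 / (δ * Real.log 2))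
  refine ⟨max N M, fun n hn => ?_⟩
  have hnN : N ≤ n := (le_max_left _ _).trans hn.le
  have hnM : (M : ℝ) ≤ n := by exact_mod_cast (le_max_right N M).trans hn.le
  have hn0 : (0 : ℝ) < n := by exact_mod_cast (Nat.zero_le _).trans_lt hn
  have hup := QInfo.concentratedInfo_le (hρ.copies n)
  have hlow := QInfo.mutualInfo_le_concentratedInfo (hρ.copies n) hs0 hs1 (hN n hnN)
  have hcard : Real.log (Fintype.card (Fin n → A))
      + Real.log (Fintype.card ((Fin n → C) × (Fin n → B))) = n * c := by
    rw [Fintype.card_prod, Fintype.card_fun, Fintype.card_fun, Fintype.card_fun, Fintype.card_fin,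
      ← mul_pow, Nat.cast_pow, Nat.cast_pow, Real.log_pow, Real.log_pow, hc, Fintype.card_prod]
    ring
  rw [hcard, QInfo.mutualInfo_copies hρ] at hlow
  rw [QInfo.mutualInfo_copies hρ] at hup
  have h24 : 24 < n * (δ * Real.log 2) := by
    rw [div_lt_iff₀ (by positivity)] at hM
    nlinarith [mul_pos hδ hl2]
  have hlow' : (QInfo.mutualInfo ρ - δ) * n < QInfo.concentratedInfo (QInfo.copies ρ n) := by
    refine lt_of_mul_lt_mul_right ?_ hl2.le
    have h1 := mul_le_mul_of_nonneg_left hs2 hn0.le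
    nlinarith
  rw [Real.dist_eq, abs_lt]
  constructor
  · rw [← lt_div_iff₀ hn0] at hlow'
    linarith
  · have : QInfo.concentratedInfo (QInfo.copies ρ n) / n ≤ QInfo.mutualInfo ρ := by
      rw [div_le_iff₀ hn0]
      linarith
    linarith
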